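/- Let $X=\{0,1\}$, let $X^n$ be the set of words of length $n$ over $X$, and let $G=\mathrm{Aut}(X^*)$ be the group of automorphisms of the binary rooted tree $X^*$ (the children of a vertex $w$ are $w0$ and $w1$). For $d\ge 1$ let $G(d)$ be the group of automorphisms of the finite binary rooted tree of depth $d$, whose vertices are the words of length at most $d$. For an automorphism $g$ and a vertex $v$ (of length less than $d$ if $g\in G(d)$), the label $g_{(v)}\in C_2=\{0,1\}$ is $1$ if $g(v0)=g(v)1$, and $0$ if $g(v0)=g(v)0$. For $0\le i\le d-1$ let $a_i\in G(d)$ be the automorphism whose only nontrivial label is the one at $0^i$. The group $G$ carries the metric in which two distinct elements $g,h$ have distance $1/[G:G_n]=1/2^{2^n-1}$, where $n$ is the smallest level that contains a vertex $u$ with $g_{(u)}\ne h_{(u)}$ and $G_n$ is the stabilizer of level $n$; Hausdorff dimension is taken with respect to this metric. A subgroup $P\le G(d)$ is called an essential pattern group of size $d$ if for every $g\in P$ and $i\in\{0,1\}$ there is $h\in P$ such that $h_{(w)}=g_{(iw)}$ for all words $w$ of length less than $d-1$. The finitely constrained group $G_P$ defined by $P$ is the group of all $g\in G$ such that for every $w\in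 X^*$ there is $p\in P$ with $g_{(wv)}=p_{(v)}$ for all words $v$ of length less than $d$. Theorem. Let $d\ge 2$ and let $P\le G(d)$ be an essential pattern group of size $d$. The following conditions are equivalent: (i) $G_P$ has Hausdorff dimension $1-1/2^{d-1}$; (ii) $P$ is a proper subgroup of $G(d)$ that contains the commutator subgroup $[G(d),G(d)]$; (iii) $P$ is a maximal subgroup of $G(d)$ that does not contain $a_{d-1}$. Moreover, for every $d\ge 2$ there are exactly $2^{d-1}$ essential pattern groups $P\le G(d)$ of size $d$ that satisfy these conditions. -/

import Mathlib

noncomputable section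

/-! ### The infinite binary rooted tree and its automorphisms

The vertices are the words over `{0, 1}`, with `0 = false` and `1 = true`; the root is the empty
word and the children of `w` are `w ++ [false]` and `w ++ [true]`. -/

theorem perm_apply_inv {α : Type} (g : Equiv.Perm α) (x : α) : g (g⁻¹ x) = x :=
  g.apply_symm_apply x

/-- The group of automorphisms of the binary rooted tree: the permutations of the vertices that
preserve the levels and the prefix relation. It acts on the left. -/
def treeAut : Subgroup (Equiv.Perm (List Bool)) where
  carrier := {g | (∀ w, (g w).length = w.length) ∧ ∀ u v, u <+: v ↔ g u <+: g v}
  mul_mem' := by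
    rintro g h ⟨hg, hg'⟩ ⟨hh, hh'⟩
    refine ⟨fun w => ?_, fun u v => ?_⟩
    · rw [Equiv.Perm.mul_apply, hg, hh]
    · rw [Equiv.Perm.mul_apply, Equiv.Perm.mul_apply, ← hg', ← hh']
  one_mem' := ⟨fun _ => rfl, fun _ _ => Iff.rfl⟩
  inv_mem' := by
    rintro g ⟨hg, hg'⟩
    refine ⟨fun w => ?_, fun u v => ?_⟩
    · rw [← hg, perm_apply_inv]
    · rw [hg' (g⁻¹ u), perm_apply_inv, perm_apply_inv]

/-- The group of all automorphisms of the binary rooted tree, as a type. -/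
abbrev TreeAut : Type := treeAut

namespace TreeAut

/-- The label (activity) of `g` at the vertex `v`, in the group of order two: it is nontrivial
exactly if `g` maps the child `v0` of `v` to the child `g(v)1` of `g(v)`. -/
def label (g : TreeAut) (v : List Bool) : ZMod 2 :=
  if g.1 (v ++ [false]) = g.1 v ++ [true] then 1 else 0

theorem apply_concat (g : TreeAut) (v : List Bool) (x : Bool) :
    g.1 (v ++ [x]) = g.1 v ++ [if g.label v = 1 then !x else x] := by
  have key : ∀ y, ∃ z, g.1 (v ++ [y]) = g.1 v ++ [z] := by
    intro y
    obtain ⟨t, ht⟩ := (g.2.2 v (v ++ [y])).1 (List.prefix_append _ _)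
    have hl := congrArg List.length ht
    rw [List.length_append, g.2.1, g.2.1, List.length_append, List.length_singleton] at hl
    obtain ⟨z, rfl⟩ := List.length_eq_one_iff.1 (by omega : t.length = 1)
    exact ⟨z, ht.symm⟩
  obtain ⟨z0, h0⟩ := key false
  obtain ⟨z1, h1⟩ := key true
  have hne : z0 ≠ z1 := by
    rintro rfl
    have := g.1.injective (h0.trans h1.symm)
    simp at this
  unfold label
  cases x <;> cases z0 <;> cases z1 <;> simp_all

theorem label_mul (g h : TreeAut) (v : List Bool) :
    (g * h).label v = g.label (h.1 v) + h.label v := by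
  have h1 := apply_concat (g * h) v false
  have h2 : (g * h).1 (v ++ [false]) = g.1 (h.1 (v ++ [false])) := rfl
  have h3 : (g * h).1 v = g.1 (h.1 v) := rfl
  rw [h2, h3, apply_concat h, apply_concat g, List.append_cancel_left_eq] at h1
  generalize (g * h).label v = a at *
  generalize g.label (h.1 v) = b at *
  generalize h.label v = c at *
  revert h1; revert a b c; decide

/-- An automorphism is determined by its labels. -/
theorem ext_label {g h : TreeAut} (H : ∀ v, g.label v = h.label v) : g = h := by
  apply Subtype.ext
  apply Equiv.ext
  intro w
  induction w using List.reverseRecOn with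
  | nil =>
    rw [List.length_eq_zero_iff.1 (g.2.1 []), List.length_eq_zero_iff.1 (h.2.1 [])]
  | append_singleton v x ih => rw [apply_concat, apply_concat, ih, H]

/-- The first level on which the labels of `g` and `h` differ (used only for `g ≠ h`). -/
def firstDiff (g h : TreeAut) : ℕ :=
  sInf {k | ∃ u : List Bool, u.length = k ∧ g.label u ≠ h.label u}

theorem label_eq_of_lt {g h : TreeAut} {u : List Bool} (hu : u.length < firstDiff g h) :
    g.label u = h.label u := by
  by_contra hne
  exact absurd (Nat.sInf_le (s := {k | ∃ u : List Bool, u.length = k ∧ g.label u ≠ h.label u})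
    ⟨u, rfl, hne⟩) (not_le.2 hu)

theorem min_firstDiff_le {g h : TreeAut} (k : TreeAut) (hne : g ≠ h) :
    min (firstDiff g k) (firstDiff k h) ≤ firstDiff g h := by
  have hex : {k | ∃ u : List Bool, u.length = k ∧ g.label u ≠ h.label u}.Nonempty := by
    by_contra hem
    refine hne (ext_label fun v => ?_)
    by_contra hv
    exact hem ⟨_, v, rfl, hv⟩
  obtain ⟨u, hu, hne'⟩ := Nat.sInf_mem hex
  by_contra! hlt
  have hlt' : u.length < min (firstDiff g k) (firstDiff k h) := by rw [hu]; exact hlt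
  exact hne' ((label_eq_of_lt (hlt'.trans_le (min_le_left _ _))).trans
    (label_eq_of_lt (hlt'.trans_le (min_le_right _ _))))

open Classical in
/-- The metric on the automorphism group: two distinct elements whose labels differ for the first
time on level `n` have distance `1 / 2 ^ (2 ^ n - 1)`. Here `2 ^ (2 ^ n - 1)` is the index of the
stabilizer of level `n`, which is the number of label patterns on the levels `0, …, n - 1`. -/
def distance (g h : TreeAut) : ℝ :=
  if g = h then 0 else 1 / 2 ^ (2 ^ firstDiff g h - 1)

theorem distance_comm (g h : TreeAut) : distance g h = distance h g := by
  have h1 : firstDiff g h = firstDiff h g := by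
    unfold firstDiff
    simp only [ne_comm (a := g.label _)]
  unfold distance
  rw [h1]
  by_cases hgh : g = h
  · rw [if_pos hgh, if_pos hgh.symm]
  · rw [if_neg hgh, if_neg (Ne.symm hgh)]

theorem distance_nonneg (g h : TreeAut) : 0 ≤ distance g h := by
  unfold distance; split_ifs <;> positivity

theorem distance_le_max (g k h : TreeAut) :
    distance g h ≤ max (distance g k) (distance k h) := by
  by_cases hgh : g = h
  · rw [distance, if_pos hgh]; exact le_max_of_le_left (distance_nonneg _ _)
  by_cases hgk : g = k
  · subst hgk; exact le_max_right _ _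
  by_cases hkh : k = h
  · subst hkh; exact le_max_left _ _
  have anti : ∀ m n : ℕ, m ≤ n → (1 : ℝ) / 2 ^ (2 ^ n - 1) ≤ 1 / 2 ^ (2 ^ m - 1) := by
    intro m n hmn
    have : (2 : ℕ) ^ m ≤ 2 ^ n := Nat.pow_le_pow_right (by norm_num) hmn
    exact one_div_le_one_div_of_le (by positivity)
      (pow_le_pow_right₀ (by norm_num) (by omega))
  rw [distance, distance, distance, if_neg hgh, if_neg hgk, if_neg hkh, le_max_iff]
  rcases min_le_iff.1 (min_firstDiff_le k hgh) with hm | hm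
  · exact Or.inl (anti _ _ hm)
  · exact Or.inr (anti _ _ hm)

instance : MetricSpace TreeAut where
  dist := distance
  dist_self g := by simp [distance]
  dist_comm := distance_comm
  dist_triangle g k h := (distance_le_max g k h).trans
    (max_le_add_of_nonneg (distance_nonneg _ _) (distance_nonneg _ _))
  eq_of_dist_eq_zero {g h} hd := by
    by_contra hne
    have hd' : distance g h = 0 := hd
    rw [distance, if_neg hne] at hd'
    have : (0 : ℝ) < 1 / 2 ^ (2 ^ firstDiff g h - 1) := by positivity
    exact this.ne' hd'

end TreeAut

/-! ### The finite binary rooted tree of depth `d` and its automorphisms -/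

/-- The vertices of the binary rooted tree of depth `d`: the words of length at most `d`. -/
abbrev FinVertex (d : ℕ) : Type := {w : List Bool // w.length ≤ d}

/-- The inner vertices of the binary rooted tree of depth `d`: the words of length less than `d`. -/
abbrev InnerVertex (d : ℕ) : Type := {w : List Bool // w.length < d}

/-- The group `G(d)` of automorphisms of the binary rooted tree of depth `d`. -/
def finTreeAut (d : ℕ) : Subgroup (Equiv.Perm (FinVertex d)) where
  carrier := {g | (∀ w, (g w).1.length = w.1.length) ∧ ∀ u v, u.1 <+: v.1 ↔ (g u).1 <+: (g v).1}
  mul_mem' := by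
    rintro g h ⟨hg, hg'⟩ ⟨hh, hh'⟩
    refine ⟨fun w => ?_, fun u v => ?_⟩
    · rw [Equiv.Perm.mul_apply, hg, hh]
    · rw [Equiv.Perm.mul_apply, Equiv.Perm.mul_apply, ← hg', ← hh']
  one_mem' := ⟨fun _ => rfl, fun _ _ => Iff.rfl⟩
  inv_mem' := by
    rintro g ⟨hg, hg'⟩
    refine ⟨fun w => ?_, fun u v => ?_⟩
    · rw [← hg, perm_apply_inv]
    · rw [hg' (g⁻¹ u), perm_apply_inv, perm_apply_inv]

/-- The group `G(d)`, as a type. -/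
abbrev FinTreeAut (d : ℕ) : Type := finTreeAut d

namespace FinTreeAut

variable {d : ℕ}

/-- The child `vx` of an inner vertex `v`. -/
def child (v : InnerVertex d) (x : Bool) : FinVertex d :=
  ⟨v.1 ++ [x], by have := v.2; simp; omega⟩

/-- An inner vertex, as a vertex. -/
def ofInner (v : InnerVertex d) : FinVertex d := ⟨v.1, v.2.le⟩

/-- The label (activity) of `g` at the inner vertex `v`. -/
def label (g : FinTreeAut d) (v : InnerVertex d) : ZMod 2 :=
  if (g.1 (child v false)).1 = (g.1 (ofInner v)).1 ++ [true] then 1 else 0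

theorem apply_child (g : FinTreeAut d) (v : InnerVertex d) (x : Bool) :
    (g.1 (child v x)).1 = (g.1 (ofInner v)).1 ++ [if g.label v = 1 then !x else x] := by
  have key : ∀ y, ∃ z, (g.1 (child v y)).1 = (g.1 (ofInner v)).1 ++ [z] := by
    intro y
    obtain ⟨t, ht⟩ := (g.2.2 (ofInner v) (child v y)).1 (List.prefix_append _ _)
    have hl := congrArg List.length ht
    rw [List.length_append, g.2.1, g.2.1] at hl
    have hl' : v.1.length + t.length = v.1.length + 1 := by simpa [child, ofInner] using hl
    obtain ⟨z, rfl⟩ := List.length_eq_one_iff.1 (by omega : t.length = 1)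
    exact ⟨z, ht.symm⟩
  obtain ⟨z0, h0⟩ := key false
  obtain ⟨z1, h1⟩ := key true
  have hne : z0 ≠ z1 := by
    rintro rfl
    have := g.1.injective (Subtype.ext (h0.trans h1.symm))
    simp [child] at this
  unfold label
  cases x <;> cases z0 <;> cases z1 <;> simp_all

/-- The image of an inner vertex under an automorphism is an inner vertex. -/
def mapInner (g : FinTreeAut d) (v : InnerVertex d) : InnerVertex d :=
  ⟨(g.1 (ofInner v)).1, by rw [g.2.1]; exact v.2⟩

theorem label_mul (g h : FinTreeAut d) (v : InnerVertex d) :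
    (g * h).label v = g.label (mapInner h v) + h.label v := by
  have h1 := apply_child (g * h) v false
  have h4 : h.1 (child v false) = child (mapInner h v) (if h.label v = 1 then !false else false) :=
    Subtype.ext (apply_child h v false)
  have h2 : (g * h).1 (child v false) = g.1 (h.1 (child v false)) := rfl
  have h3 : (g * h).1 (ofInner v) = g.1 (ofInner (mapInner h v)) := rfl
  rw [h2, h3, h4, apply_child g, List.append_cancel_left_eq] at h1
  generalize (g * h).label v = a at *
  generalize g.label (mapInner h v) = b at *
  generalize h.label v = c at *
  clear h2 h3 h4
  revert h1; revert a b c; decide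

end FinTreeAut

/-- Exchange the two letters `0` and `1` in position `i` of a word that starts with `0 ^ i`
(positions are counted from zero); leave all other words unchanged. -/
def flipAt : ℕ → List Bool → List Bool
  | _, [] => []
  | 0, x :: u => (!x) :: u
  | i + 1, false :: u => false :: flipAt i u
  | _ + 1, true :: u => true :: u

theorem flipAt_length (i : ℕ) (w : List Bool) : (flipAt i w).length = w.length := by
  fun_induction flipAt i w <;> simp_all

theorem flipAt_flipAt (i : ℕ) (w : List Bool) : flipAt i (flipAt i w) = w := by
  fun_induction flipAt i w <;> simp_all [flipAt]

theorem flipAt_prefix (i : ℕ) (u v : List Bool) (h : u <+: v) : flipAt i u <+: flipAt i v := by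
  induction i generalizing u v with
  | zero =>
    cases u <;> cases v <;> simp_all [flipAt, List.cons_prefix_cons]
  | succ i ih =>
    rcases u with _ | ⟨x, u⟩
    · simp [flipAt]
    rcases v with _ | ⟨y, v⟩
    · simp at h
    rw [List.cons_prefix_cons] at h
    obtain ⟨rfl, h⟩ := h
    cases x
    · simpa [flipAt, List.cons_prefix_cons] using ih u v h
    · simpa [flipAt, List.cons_prefix_cons] using h

/-- The element `a_i` of `G(d)`, for `i < d`: its only nontrivial label is the one at `0 ^ i`. -/
def generatorA (d i : ℕ) : FinTreeAut d :=
  ⟨{ toFun := fun w => ⟨flipAt i w.1, by rw [flipAt_length]; exact w.2⟩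
     invFun := fun w => ⟨flipAt i w.1, by rw [flipAt_length]; exact w.2⟩
     left_inv := fun w => Subtype.ext (flipAt_flipAt i w.1)
     right_inv := fun w => Subtype.ext (flipAt_flipAt i w.1) },
   fun w => flipAt_length i w.1,
   fun u v => ⟨flipAt_prefix i u.1 v.1, fun h => by
     have := flipAt_prefix i _ _ h
     simpa [flipAt_flipAt] using this⟩⟩

/-! ### Patterns, tree subshifts and finitely constrained groups -/

/-- A pattern of size `d`: a labelling of the words of length less than `d`. -/
abbrev Pattern (d : ℕ) : Type := InnerVertex d → ZMod 2

/-- The pattern `p` appears at the vertex `w` in `g`. -/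
def Pattern.AppearsAt {d : ℕ} (p : Pattern d) (w : List Bool) (g : TreeAut) : Prop :=
  ∀ v : InnerVertex d, g.label (w ++ v.1) = p v

/-- The tree subshift defined by a set `F` of forbidden patterns of size `d`. -/
def treeSubshift {d : ℕ} (F : Set (Pattern d)) : Set TreeAut :=
  {g | ∀ p ∈ F, ∀ w : List Bool, ¬ p.AppearsAt w g}

/-- The patterns of size `d` that correspond, under the portrait map, to the elements of a
subgroup of `G(d)`. -/
def allowedPatterns {d : ℕ} (P : Subgroup (FinTreeAut d)) : Set (Pattern d) :=
  {p | ∃ g ∈ P, FinTreeAut.label g = p}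

/-- `P` is an essential pattern group (of size `d`): for all `g ∈ P` and each letter `i` there is
an element `h ∈ P` with `h_(w) = g_(iw)` for all words `w` of length less than `d - 1`. -/
def IsEssential {d : ℕ} (P : Subgroup (FinTreeAut d)) : Prop :=
  ∀ g ∈ P, ∀ i : Bool, ∃ h ∈ P, ∀ (w : List Bool) (hw : w.length + 1 < d),
    FinTreeAut.label h ⟨w, by omega⟩ = FinTreeAut.label g ⟨i :: w, hw⟩

theorem mem_treeSubshift_compl_allowed {d : ℕ} {P : Subgroup (FinTreeAut d)} {g : TreeAut} :
    g ∈ treeSubshift (allowedPatterns P)ᶜ ↔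
      ∀ w : List Bool, ∃ p ∈ P, ∀ v : InnerVertex d, g.label (w ++ v.1) = FinTreeAut.label p v := by
  constructor
  · intro hg w
    by_contra hcon
    refine hg (fun v => g.label (w ++ v.1)) ?_ w (fun _ => rfl)
    rintro ⟨p, hp, hpe⟩
    exact hcon ⟨p, hp, fun v => (congrFun hpe v).symm⟩
  · rintro hg q hq w hap
    obtain ⟨p, hp, hpe⟩ := hg w
    exact hq ⟨p, hp, funext fun v => (hpe v).symm.trans (hap v)⟩

theorem apply_append_of_label {d : ℕ} {g : TreeAut} {p : FinTreeAut d} {w : List Bool}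
    (H : ∀ v : InnerVertex d, g.label (w ++ v.1) = FinTreeAut.label p v) (v : List Bool)
    (hv : v.length ≤ d) : g.1 (w ++ v) = g.1 w ++ (p.1 ⟨v, hv⟩).1 := by
  induction v using List.reverseRecOn with
  | nil =>
    have : (p.1 ⟨[], hv⟩).1 = [] := List.length_eq_zero_iff.1 (p.2.1 ⟨[], hv⟩)
    simp [this]
  | append_singleton v x ih =>
    have hv' : v.length < d := by simp at hv; omega
    have h1 := FinTreeAut.apply_child p ⟨v, hv'⟩ x
    have h2 : FinTreeAut.child (⟨v, hv'⟩ : InnerVertex d) x = ⟨v ++ [x], hv⟩ := rfl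
    have h3 : FinTreeAut.ofInner (⟨v, hv'⟩ : InnerVertex d) = ⟨v, hv'.le⟩ := rfl
    rw [h2, h3] at h1
    have h4 := H ⟨v, hv'⟩
    dsimp only at h4
    rw [h1, ← List.append_assoc, TreeAut.apply_concat, ih hv'.le, h4, List.append_assoc]

/-- The finitely constrained group `G_P` defined by the pattern group `P`: the tree subshift whose
forbidden patterns are the patterns of size `d` that do not come from an element of `P`. -/
def constrainedGroup {d : ℕ} (P : Subgroup (FinTreeAut d)) : Subgroup TreeAut where
  carrier := treeSubshift (allowedPatterns P)ᶜ
  one_mem' := by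
    rw [mem_treeSubshift_compl_allowed]
    refine fun w => ⟨1, P.one_mem, fun v => ?_⟩
    simp [TreeAut.label, FinTreeAut.label, FinTreeAut.child, FinTreeAut.ofInner]
  mul_mem' := by
    intro g h hg hh
    rw [mem_treeSubshift_compl_allowed] at hg hh ⊢
    intro w
    obtain ⟨q, hq, hqe⟩ := hh w
    obtain ⟨p, hp, hpe⟩ := hg (h.1 w)
    refine ⟨p * q, P.mul_mem hp hq, fun v => ?_⟩
    rw [TreeAut.label_mul, FinTreeAut.label_mul, hqe, apply_append_of_label hqe v.1 v.2.le]
    congr 1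
    exact hpe (FinTreeAut.mapInner q v)
  inv_mem' := by
    intro g hg
    rw [mem_treeSubshift_compl_allowed] at hg ⊢
    intro w
    obtain ⟨p, hp, hpe⟩ := hg (g⁻¹.1 w)
    refine ⟨p⁻¹, P.inv_mem hp, fun v => ?_⟩
    have e1 : (0 : ZMod 2) = g.label (g⁻¹.1 (w ++ v.1)) + g⁻¹.label (w ++ v.1) := by
      rw [← TreeAut.label_mul, mul_inv_cancel]; simp [TreeAut.label]
    have e2 : (0 : ZMod 2) =
        FinTreeAut.label p (FinTreeAut.mapInner p⁻¹ v) + FinTreeAut.label p⁻¹ v := by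
      rw [← FinTreeAut.label_mul, mul_inv_cancel]
      simp [FinTreeAut.label, FinTreeAut.child, FinTreeAut.ofInner]
    have e3 : g⁻¹.1 (w ++ v.1) = g⁻¹.1 w ++ (FinTreeAut.mapInner p⁻¹ v).1 := by
      apply g.1.injective
      rw [apply_append_of_label hpe _ (FinTreeAut.mapInner p⁻¹ v).2.le]
      have a1 : ∀ u, g.1 (g⁻¹.1 u) = u := fun u => perm_apply_inv g.1 u
      have a2 : ∀ u, p.1 (p⁻¹.1 u) = u := fun u => perm_apply_inv p.1 u
      rw [a1, a1]
      congr 1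
      exact (congrArg Subtype.val (a2 (FinTreeAut.ofInner v))).symm
    rw [e3, hpe] at e1
    exact add_left_cancel (e1.symm.trans e2)

end

/-! ### Automorphisms with prescribed labels -/

/-! Let `K = levelStabilizer d (d - 1)`, an elementary abelian group of order `2 ^ 2 ^ (d - 1)`. An
element of `G_P` is built by choosing its labels on the first `d - 1` levels and then, at each word,
one element of `P ⊓ K`. Counting these choices gives covers showing that the dimension is at most
`log₂ |P ⊓ K| / 2 ^ (d - 1)` (`dimH_constrainedGroup_le`).

(i) ⇒ (ii): the dimension forces `P ⊓ K` to have index at most 2 in `K`. Then `P ⊓ K` has enough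
elements supported below one child of the root that essentiality, by passing to sections, makes `P`
surject onto `G(d) / K`. Hence `P` is everything or has index 2 (`eq_top_or_index_eq_two`). The
first case is excluded because `G_P` would be too large; a subgroup of index 2 is proper and
contains all commutators.

(ii) ⇒ (iii): the abelianization of `G(d)` is detected by the sums of labels on the levels
(`mem_commutator_of_levelSum`). Automorphisms with two equal sections and trivial root label are
therefore in the commutator subgroup, so essentiality again gives surjectivity onto `G(d) / K`.
Modulo commutators `K` is generated by `a_{d-1}`, which leaves room for nothing between `P` and
`G(d)`, and for `a_{d-1}` only outside `P`.

(iii) ⇒ (i): a maximal subgroup of a 2-group has index 2, so `P` imposes exactly one condition on a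
pattern, and it can be met by adjusting the label at `0 ^ (d - 1)` (`exists_correction`). Thus `G_P`
has elements with arbitrary labels at all words not ending with `0 ^ (d - 1)`. Reading these labels
as binary digits is a Hölder map onto `[0, 1)`, which bounds the dimension below
(`le_dimH_of_free_labels`). The counting bound gives the other inequality.

For the count, subgroups of index 2 are kernels of homomorphisms to the group of order two. Such a
homomorphism is determined by its values on the `a_i`; the value on `a_{d-1}` is forced and the
others are free. Essentiality is automatic, again by `exists_correction`. -/

theorem zmod_two_cases (x : ZMod 2) : x = 0 ∨ x = 1 := by
  revert x; decide

theorem zmod_two_add_self (x : ZMod 2) : x + x = 0 := by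
  revert x; decide

/-- The action on words of the tree automorphism with the labels `p`. -/
def portraitAct : (List Bool → ZMod 2) → List Bool → List Bool
  | _, [] => []
  | p, x :: w => (if p [] = 1 then !x else x) :: portraitAct (fun u => p (x :: u)) w

/-- The inverse of `portraitAct`. -/
def portraitInv : (List Bool → ZMod 2) → List Bool → List Bool
  | _, [] => []
  | p, y :: w => (if p [] = 1 then !y else y) ::
      portraitInv (fun u => p ((if p [] = 1 then !y else y) :: u)) w

theorem portraitAct_length (p : List Bool → ZMod 2) (w : List Bool) :
    (portraitAct p w).length = w.length := by
  induction w generalizing p with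
  | nil => rfl
  | cons x w ih => simp [portraitAct, ih]

theorem portraitInv_length (p : List Bool → ZMod 2) (w : List Bool) :
    (portraitInv p w).length = w.length := by
  induction w generalizing p with
  | nil => rfl
  | cons x w ih => simp [portraitInv, ih]

theorem portraitInv_act (p : List Bool → ZMod 2) (w : List Bool) :
    portraitInv p (portraitAct p w) = w := by
  induction w generalizing p with
  | nil => rfl
  | cons x w ih => by_cases h : p [] = 1 <;> simp [portraitAct, portraitInv, h, ih]

theorem portraitAct_inv (p : List Bool → ZMod 2) (w : List Bool) :
    portraitAct p (portraitInv p w) = w := by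
  induction w generalizing p with
  | nil => rfl
  | cons x w ih => by_cases h : p [] = 1 <;> simp [portraitAct, portraitInv, h, ih]

theorem portraitAct_prefix (p : List Bool → ZMod 2) {u v : List Bool} (h : u <+: v) :
    portraitAct p u <+: portraitAct p v := by
  induction u generalizing p v with
  | nil => simp [portraitAct]
  | cons x u ih =>
    obtain ⟨t, rfl⟩ := h
    rw [List.cons_append, portraitAct, portraitAct, List.cons_prefix_cons]
    exact ⟨rfl, ih _ (List.prefix_append _ _)⟩

theorem portraitInv_prefix (p : List Bool → ZMod 2) {u v : List Bool} (h : u <+: v) :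
    portraitInv p u <+: portraitInv p v := by
  induction u generalizing p v with
  | nil => simp [portraitInv]
  | cons x u ih =>
    obtain ⟨t, rfl⟩ := h
    rw [List.cons_append, portraitInv, portraitInv, List.cons_prefix_cons]
    exact ⟨rfl, ih _ (List.prefix_append _ _)⟩

theorem portraitAct_prefix_iff (p : List Bool → ZMod 2) (u v : List Bool) :
    u <+: v ↔ portraitAct p u <+: portraitAct p v :=
  ⟨portraitAct_prefix p, fun h => by
    simpa only [portraitInv_act] using portraitInv_prefix p h⟩

theorem portraitAct_concat (p : List Bool → ZMod 2) (v : List Bool) (x : Bool) :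
    portraitAct p (v ++ [x]) = portraitAct p v ++ [if p v = 1 then !x else x] := by
  induction v generalizing p with
  | nil => simp [portraitAct]
  | cons y v ih => simp [portraitAct, ih]

/-- The automorphism of the infinite tree with the labels `p`. -/
def TreeAut.ofLabel (p : List Bool → ZMod 2) : TreeAut :=
  ⟨{ toFun := portraitAct p
     invFun := portraitInv p
     left_inv := portraitInv_act p
     right_inv := portraitAct_inv p },
   portraitAct_length p, portraitAct_prefix_iff p⟩

theorem TreeAut.label_ofLabel (p : List Bool → ZMod 2) (v : List Bool) :
    (TreeAut.ofLabel p).label v = p v := by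
  have h : (TreeAut.ofLabel p).label v =
    if portraitAct p (v ++ [false]) = portraitAct p v ++ [true] then 1 else 0 := rfl
  rw [h, portraitAct_concat]
  rcases zmod_two_cases (p v) with h | h <;> simp [h]

namespace FinTreeAut

variable {d : ℕ}

/-- The automorphism of the finite tree with the labels `p` at the inner vertices. -/
def ofLabel (d : ℕ) (p : List Bool → ZMod 2) : FinTreeAut d :=
  ⟨{ toFun := fun w => ⟨portraitAct p w.1, by rw [portraitAct_length]; exact w.2⟩
     invFun := fun w => ⟨portraitInv p w.1, by rw [portraitInv_length]; exact w.2⟩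
     left_inv := fun w => Subtype.ext (portraitInv_act p w.1)
     right_inv := fun w => Subtype.ext (portraitAct_inv p w.1) },
   fun w => portraitAct_length p w.1, fun u v => portraitAct_prefix_iff p u.1 v.1⟩

theorem label_ofLabel (p : List Bool → ZMod 2) (v : InnerVertex d) :
    (ofLabel d p).label v = p v.1 := by
  have h : (ofLabel d p).label v =
    if portraitAct p (v.1 ++ [false]) = portraitAct p v.1 ++ [true] then 1 else 0 := rfl
  rw [h, portraitAct_concat]
  rcases zmod_two_cases (p v.1) with h | h <;> simp [h]

/-- A word is fixed if all labels above it are trivial. -/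
theorem apply_eq_self (g : FinTreeAut d) (w : List Bool) (hw : w.length ≤ d)
    (h : ∀ (u : List Bool) (hu : u.length < d), u <+: w → u.length < w.length →
      g.label ⟨u, hu⟩ = 0) : (g.1 ⟨w, hw⟩).1 = w := by
  induction w using List.reverseRecOn with
  | nil => exact List.length_eq_zero_iff.1 (g.2.1 ⟨[], hw⟩)
  | append_singleton v x ih =>
    have hv : v.length < d := by simp at hw; omega
    have h1 := apply_child g ⟨v, hv⟩ x
    rw [h v hv (List.prefix_append _ _) (by simp)] at h1
    have h2 : (g.1 ⟨v, hv.le⟩).1 = v := ih hv.le fun u hu huv hl =>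
      h u hu (huv.trans (List.prefix_append _ _)) (by simp; omega)
    have h3 : (g.1 (ofInner ⟨v, hv⟩)).1 = v := h2
    rw [h3] at h1
    exact h1.trans (by simp)

theorem mapInner_eq_self (g : FinTreeAut d) (v : InnerVertex d)
    (h : ∀ u : InnerVertex d, u.1.length < v.1.length → g.label u = 0) : mapInner g v = v :=
  Subtype.ext (apply_eq_self g v.1 v.2.le fun u hu _ hl => h ⟨u, hu⟩ hl)

/-- An automorphism of the finite tree is determined by its labels. -/
theorem ext_label {g h : FinTreeAut d} (H : ∀ v, g.label v = h.label v) : g = h := by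
  apply Subtype.ext
  apply Equiv.ext
  rintro ⟨w, hw⟩
  apply Subtype.ext
  induction w using List.reverseRecOn with
  | nil =>
    rw [List.length_eq_zero_iff.1 (g.2.1 ⟨[], hw⟩), List.length_eq_zero_iff.1 (h.2.1 ⟨[], hw⟩)]
  | append_singleton v x ih =>
    have hv : v.length < d := by simp at hw; omega
    have e1 := apply_child g ⟨v, hv⟩ x
    have e2 := apply_child h ⟨v, hv⟩ x
    have e3 : (g.1 (ofInner ⟨v, hv⟩)).1 = (h.1 (ofInner ⟨v, hv⟩)).1 := ih hv.le
    rw [e3, H, ← e2] at e1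
    exact e1

/-- A pattern, as a labelling of all words. -/
def extendPattern (p : Pattern d) (w : List Bool) : ZMod 2 :=
  if h : w.length < d then p ⟨w, h⟩ else 0

theorem extendPattern_apply (p : Pattern d) (v : InnerVertex d) :
    extendPattern p v.1 = p v := by
  simp [extendPattern, v.2]

/-- The group `G(d)` is in bijection with the patterns of size `d`. -/
def labelEquiv (d : ℕ) : FinTreeAut d ≃ Pattern d where
  toFun := label
  invFun p := ofLabel d (extendPattern p)
  left_inv g := ext_label fun v => by rw [label_ofLabel, extendPattern_apply]
  right_inv p := funext fun v => by rw [label_ofLabel, extendPattern_apply]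

theorem label_one (v : InnerVertex d) : (1 : FinTreeAut d).label v = 0 := by
  simp [label, child, ofInner]

theorem mapInner_mul (g h : FinTreeAut d) (v : InnerVertex d) :
    mapInner (g * h) v = mapInner g (mapInner h v) := rfl

theorem mapInner_bijective (g : FinTreeAut d) : Function.Bijective (mapInner g) := by
  refine Function.bijective_iff_has_inverse.2 ⟨mapInner g⁻¹, fun v => ?_, fun v => ?_⟩
  · rw [← mapInner_mul, inv_mul_cancel]; rfl
  · rw [← mapInner_mul, mul_inv_cancel]; rfl

theorem mapInner_length (g : FinTreeAut d) (v : InnerVertex d) :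
    (mapInner g v).1.length = v.1.length := g.2.1 (ofInner v)

noncomputable instance instFintypeInnerVertex (d : ℕ) : Fintype (InnerVertex d) :=
  (List.finite_length_lt Bool d).fintype

instance : Finite (FinTreeAut d) := Finite.of_equiv _ (labelEquiv d).symm

/-- The labels of a product in which the right factor has trivial labels above level `j`. -/
theorem label_mul_of_trivial (g h : FinTreeAut d) {j : ℕ} (hh : ∀ u, u.1.length < j → h.label u = 0)
    (v : InnerVertex d) (hv : v.1.length ≤ j) : (g * h).label v = g.label v + h.label v := by
  rw [label_mul, mapInner_eq_self h v fun u hu => hh u (by omega)]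

/-! ### Generators and homomorphisms to commutative groups -/

/-- The automorphism whose only nontrivial label is the one at `v`. -/
def single (v : InnerVertex d) : FinTreeAut d :=
  ofLabel d fun w => if w = v.1 then 1 else 0

theorem label_single (v u : InnerVertex d) : (single v).label u = if u = v then 1 else 0 := by
  rw [single, label_ofLabel]
  simp only [Subtype.ext_iff]

theorem mapInner_single_self (v : InnerVertex d) : mapInner (single v) v = v :=
  mapInner_eq_self _ _ fun u hu => by
    rw [label_single, if_neg]
    rintro rfl
    exact lt_irrefl _ hu

/-- The set of vertices with a nontrivial label. -/
noncomputable def support (g : FinTreeAut d) : Finset (InnerVertex d) :=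
  Finset.univ.filter fun v => g.label v ≠ 0

/-- Since `single v` fixes `v`, right multiplication by it cancels the label there and only permutes
the positions of the other labels. So `mapInner (single v)` embeds the new support into the old one
without `v`. -/
theorem card_support_mul_single_lt {g : FinTreeAut d} {v : InnerVertex d} (hv : g.label v ≠ 0) :
    (support (g * single v)).card < (support g).card := by
  classical
  have hmem : v ∈ support g := by simpa [support] using hv
  refine lt_of_le_of_lt (Finset.card_le_card_of_injOn (t := (support g).erase v)
    (mapInner (single v)) ?_ (mapInner_bijective (single v)).1.injOn)
    (Finset.card_erase_lt_of_mem hmem)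
  intro u hu
  have hu' : g.label (mapInner (single v) u) + (if u = v then 1 else 0) ≠ 0 := by
    simpa [support, label_mul, label_single] using hu
  have huv : u ≠ v := by
    rintro rfl
    rw [mapInner_single_self, if_pos rfl, (zmod_two_cases (g.label u)).resolve_left hv] at hu'
    exact hu' (by decide)
  rw [if_neg huv, add_zero] at hu'
  have hne : mapInner (single v) u ≠ v := fun h =>
    huv ((mapInner_bijective (single v)).1 (h.trans (mapInner_single_self v).symm))
  simp [support, hu', hne]

theorem eq_top_of_single_mem {H : Subgroup (FinTreeAut d)} (h : ∀ v, single v ∈ H) : H = ⊤ := by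
  rw [eq_top_iff]
  intro g _
  induction hn : (support g).card using Nat.strong_induction_on generalizing g with
  | _ n ih =>
    by_cases hg : ∃ v, g.label v ≠ 0
    · obtain ⟨v, hv⟩ := hg
      have := ih _ (hn ▸ card_support_mul_single_lt hv) (g := g * single v) trivial rfl
      exact (H.mul_mem_cancel_right (h v)).1 this
    · push Not at hg
      have : g = 1 := ext_label fun v => by rw [hg, label_one]
      exact this ▸ H.one_mem

end FinTreeAut

theorem flipAt_concat (i : ℕ) (v : List Bool) (x : Bool) :
    flipAt i (v ++ [x]) = flipAt i v ++ [if v = List.replicate i false then !x else x] := by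
  induction i generalizing v with
  | zero => cases v <;> simp [flipAt]
  | succ i ih =>
    rcases v with _ | ⟨_ | _, v⟩
    · cases x <;> simp [flipAt, List.replicate_succ]
    all_goals simp [flipAt, List.replicate_succ, ih]

namespace FinTreeAut

variable {d : ℕ}

theorem label_generatorA (i : ℕ) (v : InnerVertex d) :
    (generatorA d i).label v = if v.1 = List.replicate i false then 1 else 0 := by
  have h : (generatorA d i).label v =
    if flipAt i (v.1 ++ [false]) = flipAt i v.1 ++ [true] then 1 else 0 := rfl
  rw [h, flipAt_concat]
  by_cases h : v.1 = List.replicate i false <;> simp [h]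

/-- The automorphism that flips a whole level exactly when the letter of `v` in that position is `1`
carries `v` to the leftmost word. -/
theorem portraitAct_getD (v : List Bool) :
    portraitAct (fun u => if v.getD u.length false then 1 else 0) v =
      List.replicate v.length false := by
  induction v with
  | nil => rfl
  | cons x v ih =>
    simp only [portraitAct, List.length_cons, List.replicate_succ, List.getD_cons_succ, ih]
    cases x <;> simp

/-- The conjugating element has labels that depend only on the level, so they contribute equally to
both products. What remains is that it maps `v`, and no other vertex, to the leftmost vertex of its
level. -/
theorem exists_conj_single (v : InnerVertex d) :
    ∃ h : FinTreeAut d, h * single v = generatorA d v.1.length * h := by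
  refine ⟨ofLabel d fun u => if v.1.getD u.length false then 1 else 0, ext_label fun u => ?_⟩
  rw [label_mul, label_mul, label_ofLabel, label_ofLabel, mapInner_length, label_single,
    label_generatorA, add_comm]
  congr 2
  have h1 : ((mapInner (ofLabel d fun u => if v.1.getD u.length false then 1 else 0) v).1 =
    List.replicate v.1.length false) := portraitAct_getD v.1
  rw [← h1, ← Subtype.ext_iff, (mapInner_bijective _).1.eq_iff]

/-- The automorphisms with a single nontrivial label generate `G(d)`, and those on one level are
conjugate, hence indistinguishable in a commutative group. -/
theorem hom_ext {A : Type*} [CommGroup A] {f₁ f₂ : FinTreeAut d →* A}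
    (h : ∀ i < d, f₁ (generatorA d i) = f₂ (generatorA d i)) : f₁ = f₂ := by
  have key : ∀ (f : FinTreeAut d →* A) v, f (single v) = f (generatorA d v.1.length) := by
    intro f v
    obtain ⟨k, hk⟩ := exists_conj_single v
    have := congrArg f hk
    rw [map_mul, map_mul, mul_comm] at this
    exact mul_right_cancel this
  have htop : f₁.eqLocus f₂ = ⊤ := eq_top_of_single_mem fun v => by
    change f₁ (single v) = f₂ (single v)
    rw [key, key, h _ v.2]
  ext g
  have : g ∈ f₁.eqLocus f₂ := htop ▸ Subgroup.mem_top g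
  exact this

/-- The sum of the labels on level `i`, as a homomorphism. -/
noncomputable def levelSum (i : ℕ) : FinTreeAut d →* Multiplicative (ZMod 2) where
  toFun g := Multiplicative.ofAdd (∑ v : InnerVertex d, if v.1.length = i then g.label v else 0)
  map_one' := by simp [label_one]
  map_mul' g h := by
    rw [← ofAdd_add]
    congr 1
    have h1 : (∑ v : InnerVertex d, if v.1.length = i then g.label v else 0) =
        ∑ v : InnerVertex d, if v.1.length = i then g.label (mapInner h v) else 0 := by
      rw [← (mapInner_bijective h).sum_comp]
      simp only [mapInner_length]
    rw [h1, ← Finset.sum_add_distrib]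
    refine Finset.sum_congr rfl fun v _ => ?_
    split_ifs
    · rw [label_mul]
    · rw [add_zero]

theorem levelSum_apply (i : ℕ) (g : FinTreeAut d) : levelSum i g =
    Multiplicative.ofAdd (∑ v : InnerVertex d, if v.1.length = i then g.label v else 0) := rfl

theorem levelSum_generatorA (i j : ℕ) (hj : j < d) : levelSum i (generatorA d j) =
    Multiplicative.ofAdd (if j = i then (1 : ZMod 2) else 0) := by
  rw [levelSum_apply, Finset.sum_eq_single ⟨List.replicate j false, by simpa using hj⟩]
  · simp [label_generatorA]
  · intro v _ hv
    rw [label_generatorA, if_neg fun h => hv (Subtype.ext h), ite_self]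
  · simp

theorem generatorA_mul_self (i : ℕ) : generatorA d i * generatorA d i = 1 :=
  Subtype.ext (Equiv.ext fun w => Subtype.ext (flipAt_flipAt i w.1))

/-- The homomorphism of the group of order two into a group that is given by an involution. -/
def zmodTwoHom {A : Type*} [Group A] (a : A) (ha : a * a = 1) : Multiplicative (ZMod 2) →* A where
  toFun x := if x.toAdd = 1 then a else 1
  map_one' := by simp
  map_mul' x y := by
    rw [toAdd_mul]
    rcases zmod_two_cases x.toAdd with hx | hx <;> rcases zmod_two_cases y.toAdd with hy | hy <;>
      simp [hx, hy, ha, show (1 + 1 : ZMod 2) = 0 from rfl]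

/-- An element whose level sums are all trivial belongs to the commutator subgroup. -/
theorem mem_commutator_of_levelSum {g : FinTreeAut d} (hg : ∀ i < d, levelSum i g = 1) :
    g ∈ commutator (FinTreeAut d) := by
  let f : FinTreeAut d →* Abelianization (FinTreeAut d) := Abelianization.of
  have hf : ∀ i, f (generatorA d i) * f (generatorA d i) = 1 := fun i => by
    rw [← map_mul, generatorA_mul_self, map_one]
  -- The abelianization map factors through the level sums: both sides agree on every `a_j`.
  have h1 : f = ∏ i ∈ Finset.range d, (zmodTwoHom (f (generatorA d i)) (hf i)).comp (levelSum i) := by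
    refine hom_ext fun j hj => ?_
    rw [MonoidHom.finsetProd_apply, Finset.prod_eq_single j]
    · rw [MonoidHom.comp_apply, levelSum_generatorA _ _ hj, if_pos rfl]
      simp [zmodTwoHom]
    · intro i _ hij
      rw [MonoidHom.comp_apply, levelSum_generatorA _ _ hj, if_neg hij.symm]
      simp [zmodTwoHom]
    · intro h; exact absurd (Finset.mem_range.2 hj) h
  have h2 : f g = 1 := by
    rw [h1, MonoidHom.finsetProd_apply]
    refine Finset.prod_eq_one fun i hi => ?_
    rw [MonoidHom.comp_apply, hg i (Finset.mem_range.1 hi), map_one]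
  rwa [← Abelianization.ker_of, MonoidHom.mem_ker]

end FinTreeAut

/-! ### Subgroups of index two -/

/-- In a finite 2-group every proper subgroup has index 2 in some larger subgroup, by Sylow theory;
for a maximal subgroup this must be the whole group. -/
theorem index_eq_two_of_isCoatom {G : Type*} [Group G] [Finite G] {k : ℕ} (hG : Nat.card G = 2 ^ k)
    {P : Subgroup G} (hP : IsCoatom P) : P.index = 2 := by
  obtain ⟨j, hjk, hj⟩ := (Nat.dvd_prime_pow Nat.prime_two).1 (hG ▸ P.card_subgroup_dvd_card)
  have hlt : j < k := by
    refine lt_of_le_of_ne hjk ?_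
    rintro rfl
    exact hP.1 (Subgroup.eq_top_of_card_eq P (hj.trans hG.symm))
  have : Fact (Nat.Prime 2) := ⟨Nat.prime_two⟩
  obtain ⟨K, hK, hPK⟩ := Sylow.exists_subgroup_card_pow_succ (p := 2) (n := j)
    (hG ▸ pow_dvd_pow 2 hlt) hj
  have hne : P ≠ K := by
    rintro rfl
    rw [hj] at hK
    exact absurd (Nat.pow_right_injective le_rfl hK) (by omega)
  have hKtop := hP.2 K (lt_of_le_of_ne hPK hne)
  rw [hKtop, Subgroup.card_top] at hK
  have h := P.card_mul_index
  rw [hj, hK, pow_succ] at h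
  exact Nat.eq_of_mul_eq_mul_left (by positivity) h

theorem isCoatom_of_index_eq_two {G : Type*} [Group G] {P : Subgroup G} (hP : P.index = 2) :
    IsCoatom P := by
  refine ⟨fun h => by simp [h] at hP, fun Q hQ => ?_⟩
  obtain ⟨q, hq, hqP⟩ := SetLike.exists_of_lt hQ
  rw [eq_top_iff]
  intro x _
  by_cases hx : x ∈ P
  · exact hQ.le hx
  · have : q * x ∈ P := (Subgroup.mul_mem_iff_of_index_two hP).2 (by simp [hqP, hx])
    exact (Q.mul_mem_cancel_left hq).1 (hQ.le this)

theorem commutator_le_of_index_eq_two {G : Type*} [Group G] {P : Subgroup G} (hP : P.index = 2) :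
    commutator G ≤ P := by
  rw [commutator_def, Subgroup.commutator_le]
  intro a _ b _
  rw [commutatorElement_def]
  simp only [Subgroup.mul_mem_iff_of_index_two hP, P.inv_mem_iff]
  tauto

/-- The homomorphism to the group of order two with a given kernel of index two. -/
noncomputable def indexTwoHom {G : Type*} [Group G] (P : Subgroup G) (hP : P.index = 2) :
    G →* Multiplicative (ZMod 2) where
  toFun g := open Classical in Multiplicative.ofAdd (if g ∈ P then 0 else 1)
  map_one' := by simp
  map_mul' x y := by
    rw [← ofAdd_add]
    by_cases hx : x ∈ P <;> by_cases hy : y ∈ P <;>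
      simp [Subgroup.mul_mem_iff_of_index_two hP, hx, hy, show (1 + 1 : ZMod 2) = 0 from rfl]

theorem indexTwoHom_eq_one_iff {G : Type*} [Group G] {P : Subgroup G} (hP : P.index = 2) {g : G} :
    indexTwoHom P hP g = 1 ↔ g ∈ P := by
  simp [indexTwoHom]

namespace FinTreeAut

variable {d : ℕ}

theorem card_eq_two_pow (d : ℕ) :
    Nat.card (FinTreeAut d) = 2 ^ Fintype.card (InnerVertex d) := by
  rw [Nat.card_congr (labelEquiv d), Nat.card_fun, Nat.card_zmod, Nat.card_eq_fintype_card]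

theorem label_mul_generatorA_last (g : FinTreeAut d) (v : InnerVertex d) :
    (g * generatorA d (d - 1)).label v =
      g.label v + if v.1 = List.replicate (d - 1) false then 1 else 0 := by
  rw [label_mul_of_trivial g _ (j := d - 1) _ _ (by have := v.2; omega), label_generatorA]
  intro u hu
  rw [label_generatorA, if_neg]
  intro h
  rw [h, List.length_replicate] at hu
  exact lt_irrefl _ hu

/-- If `P` has index two and does not contain `a_{d-1}`, then every pattern becomes the pattern of
an element of `P` after changing at most the label at `0 ^ (d - 1)`. -/
theorem exists_correction {P : Subgroup (FinTreeAut d)} (hP : P.index = 2)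
    (ha : generatorA d (d - 1) ∉ P) (p : Pattern d) :
    ∃ b : ZMod 2, ∃ g ∈ P, ∀ v,
      label g v = if v.1 = List.replicate (d - 1) false then b else p v := by
  have hg : ∀ v, label ((labelEquiv d).symm p) v = p v := fun v =>
    congrFun ((labelEquiv d).apply_symm_apply p) v
  have hp : ∀ v : InnerVertex d, v.1 = List.replicate (d - 1) false →
      p v = extendPattern p (List.replicate (d - 1) false) := fun v hv => by
    rw [← hv, extendPattern_apply]
  by_cases hmem : (labelEquiv d).symm p ∈ P
  · refine ⟨extendPattern p (List.replicate (d - 1) false), _, hmem, fun v => ?_⟩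
    rw [hg]
    split_ifs with hv
    · exact hp v hv
    · rfl
  -- Two elements outside a subgroup of index 2 have their product inside, and right multiplication
  -- by `a_{d-1}` changes only the label at `0 ^ (d - 1)`.
  · refine ⟨extendPattern p (List.replicate (d - 1) false) + 1, _,
      (Subgroup.mul_mem_iff_of_index_two hP).2 (iff_of_false hmem ha), fun v => ?_⟩
    rw [label_mul_generatorA_last, hg]
    split_ifs with hv
    · rw [hp v hv]
    · rw [add_zero]

/-! ### Level stabilizers, and pattern groups that contain the commutator subgroup -/

/-- The stabilizer of level `j`: the elements with trivial labels on the levels below `j`. -/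
def levelStabilizer (d j : ℕ) : Subgroup (FinTreeAut d) where
  carrier := {g | ∀ v : InnerVertex d, v.1.length < j → g.label v = 0}
  one_mem' := fun v _ => label_one v
  mul_mem' := by
    intro g h hg hh v hv
    rw [label_mul, hg _ (by rwa [mapInner_length]), hh v hv, add_zero]
  inv_mem' := by
    intro g hg v hv
    have h := label_mul g g⁻¹ v
    rw [mul_inv_cancel, label_one, hg _ (by rwa [mapInner_length]), zero_add] at h
    exact h.symm

theorem mul_inv_mem_levelStabilizer {j : ℕ} {g h : FinTreeAut d}
    (H : ∀ v : InnerVertex d, v.1.length < j → g.label v = h.label v) :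
    g * h⁻¹ ∈ levelStabilizer d j := by
  intro v hv
  obtain ⟨u, rfl⟩ := (mapInner_bijective h).2 v
  rw [mapInner_length] at hv
  have := label_mul (g * h⁻¹) h u
  rw [inv_mul_cancel_right, H u hv] at this
  simpa using this

theorem generatorA_mem_levelStabilizer (d j : ℕ) : generatorA d j ∈ levelStabilizer d j := by
  intro v hv
  rw [label_generatorA, if_neg]
  intro h
  rw [h, List.length_replicate] at hv
  exact lt_irrefl _ hv

/-- The elements of `P` have arbitrary labels on the levels below `j`. -/
def IsFullBelow (P : Subgroup (FinTreeAut d)) (j : ℕ) : Prop :=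
  ∀ x : List Bool → ZMod 2, ∃ p ∈ P, ∀ v : InnerVertex d, v.1.length < j → p.label v = x v.1

/-- The automorphism with trivial root label and the same labels `x` below both children has level
sums zero, so it is in `P`. Essentiality then puts a section of it, with labels `x`, in `P`. -/
theorem isFullBelow_of_commutator_le {P : Subgroup (FinTreeAut d)} (hess : IsEssential P)
    (hP : commutator (FinTreeAut d) ≤ P) : IsFullBelow P (d - 1) := by
  intro x
  let y : List Bool → ZMod 2 := fun w => match w with
    | [] => 0
    | _ :: u => x u
  have hy : ∀ w, y (flipAt 0 w) = y w := by
    rintro (_ | ⟨_, w⟩) <;> rfl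
  have hmem : ofLabel d y ∈ commutator (FinTreeAut d) := by
    refine mem_commutator_of_levelSum fun i _ => ?_
    rw [levelSum_apply, ← ofAdd_zero]
    congr 1
    -- The vertices `0u` and `1u` are paired and their equal labels cancel modulo 2; the unpaired
    -- root has label zero.
    refine Finset.sum_involution (fun v _ => mapInner (generatorA d 0) v) (fun v _ => ?_)
      (fun v _ hv h => ?_) (fun _ _ => Finset.mem_univ _)
      (fun v _ => Subtype.ext (flipAt_flipAt 0 v.1))
    · have : (ofLabel d y).label (mapInner (generatorA d 0) v) = (ofLabel d y).label v := by
        rw [label_ofLabel, label_ofLabel]; exact hy v.1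
      rw [mapInner_length, this, zmod_two_add_self]
    · have h' : flipAt 0 v.1 = v.1 := congrArg Subtype.val h
      obtain ⟨_ | ⟨b, w⟩, hw⟩ := v
      · simp [label_ofLabel, y] at hv
      · simp [flipAt] at h'
  obtain ⟨h, hh, hl⟩ := hess _ (hP hmem) false
  refine ⟨h, hh, fun v hv => ?_⟩
  have hv' := hl v.1 (by omega)
  rw [label_ofLabel] at hv'
  exact hv'

theorem levelSum_eq_one_of_mem_levelStabilizer {i j : ℕ} (hij : i < j) {g : FinTreeAut d}
    (hg : g ∈ levelStabilizer d j) : levelSum i g = 1 := by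
  rw [levelSum_apply, ← ofAdd_zero]
  congr 1
  refine Finset.sum_eq_zero fun v _ => ?_
  split_ifs with h
  · exact hg v (by omega)
  · rfl

/-- On this stabilizer only the last level sum can be nontrivial, and multiplication by `a_{d-1}`
switches its value. -/
theorem mem_or_generatorA_mul_mem {P : Subgroup (FinTreeAut d)} (hP : commutator (FinTreeAut d) ≤ P)
    {k : FinTreeAut d} (hk : k ∈ levelStabilizer d (d - 1)) :
    k ∈ P ∨ generatorA d (d - 1) * k ∈ P := by
  by_cases h : levelSum (d - 1) k = 1
  · refine Or.inl (hP (mem_commutator_of_levelSum fun i hi => ?_))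
    rcases (by omega : i < d - 1 ∨ i = d - 1) with hi | rfl
    · exact levelSum_eq_one_of_mem_levelStabilizer hi hk
    · exact h
  · refine Or.inr (hP (mem_commutator_of_levelSum fun i hi => ?_))
    rcases (by omega : i < d - 1 ∨ i = d - 1) with hi' | rfl
    · exact levelSum_eq_one_of_mem_levelStabilizer hi'
        (mul_mem (generatorA_mem_levelStabilizer d _) hk)
    · rw [map_mul, levelSum_generatorA _ _ hi, if_pos rfl]
      have : levelSum (d - 1) k = Multiplicative.ofAdd 1 :=
        (zmod_two_cases (Multiplicative.toAdd (levelSum (d - 1) k))).resolve_left h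
      rw [this]; rfl

theorem eq_top_of_generatorA_mem {P : Subgroup (FinTreeAut d)} (hfull : IsFullBelow P (d - 1))
    (hP : commutator (FinTreeAut d) ≤ P) (ha : generatorA d (d - 1) ∈ P) : P = ⊤ := by
  rw [eq_top_iff]
  intro g _
  obtain ⟨h, hh, hl⟩ := hfull (extendPattern (label g))
  have hk := mul_inv_mem_levelStabilizer (g := g) (h := h) fun v hv => by
    rw [hl v hv, extendPattern_apply]
  have : g * h⁻¹ ∈ P := (mem_or_generatorA_mul_mem hP hk).elim id (P.mul_mem_cancel_left ha).1
  exact (P.mul_mem_cancel_right (P.inv_mem hh)).1 this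

theorem isCoatom_of_commutator_le {P : Subgroup (FinTreeAut d)} (hess : IsEssential P)
    (hne : P ≠ ⊤) (hP : commutator (FinTreeAut d) ≤ P) :
    IsCoatom P ∧ generatorA d (d - 1) ∉ P := by
  have hfull := isFullBelow_of_commutator_le hess hP
  refine ⟨⟨hne, fun Q hQ => ?_⟩, fun ha => hne (eq_top_of_generatorA_mem hfull hP ha)⟩
  obtain ⟨g, hgQ, hgP⟩ := SetLike.exists_of_lt hQ
  obtain ⟨h, hh, hl⟩ := hfull (extendPattern (label g))
  have hk := mul_inv_mem_levelStabilizer (g := g) (h := h) fun v hv => by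
    rw [hl v hv, extendPattern_apply]
  have hkP : g * h⁻¹ ∉ P := fun hmem => hgP ((P.mul_mem_cancel_right (P.inv_mem hh)).1 hmem)
  have hkQ : g * h⁻¹ ∈ Q := Q.mul_mem hgQ (Q.inv_mem (hQ.le hh))
  -- The quotient `g * h⁻¹` lies in `Q` but not in `P`, so `a_{d-1}` times it lies in `P`; this
  -- forces `a_{d-1}` into `Q`.
  refine eq_top_of_generatorA_mem (fun x => ?_) (hP.trans hQ.le)
    ((Q.mul_mem_cancel_right hkQ).1 (hQ.le ((mem_or_generatorA_mul_mem hP hk).resolve_left hkP)))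
  obtain ⟨p, hp, hpl⟩ := hfull x
  exact ⟨p, hQ.le hp, hpl⟩

/-! ### Essential pattern groups with many elements that are supported on the last level -/

/-- The elements of `P` with trivial labels below level `j` have arbitrary labels on level `j`. -/
def IsFullAt (P : Subgroup (FinTreeAut d)) (j : ℕ) : Prop :=
  ∀ x : List Bool → ZMod 2, ∃ p ∈ P, p ∈ levelStabilizer d j ∧
    ∀ v : InnerVertex d, v.1.length = j → p.label v = x v.1

theorem isFullBelow_of_isFullAt {P : Subgroup (FinTreeAut d)} {n : ℕ}
    (h : ∀ j < n, IsFullAt P j) : IsFullBelow P n := by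
  intro x
  induction n with
  | zero => exact ⟨1, P.one_mem, fun v hv => absurd hv (by omega)⟩
  | succ n ih =>
    obtain ⟨p, hp, hpl⟩ := ih fun j hj => h j (by omega)
    -- As `q` acts trivially down to level `n`, labels add in `p * q`; hence `q` need only supply
    -- the error of `p` on level `n`.
    obtain ⟨q, hq, hqs, hql⟩ := h n (by omega) fun w => x w - extendPattern (label p) w
    refine ⟨p * q, P.mul_mem hp hq, fun v hv => ?_⟩
    rw [label_mul_of_trivial p q hqs v (by omega)]
    rcases (by omega : v.1.length < n ∨ v.1.length = n) with h' | h'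
    · rw [hpl v h', hqs v h', add_zero]
    · rw [hql v h', extendPattern_apply, add_sub_cancel]

/-- Passing to the section at `i` lifts labels by one level, so it is enough to control the labels
of level `j + 1` on the half of the tree below `i`. -/
theorem IsFullAt.of_section {P : Subgroup (FinTreeAut d)} (hess : IsEssential P) {j : ℕ}
    (hj : j + 1 < d) (i : Bool) (h : ∀ x : List Bool → ZMod 2, ∃ p ∈ P,
      p ∈ levelStabilizer d (j + 1) ∧
        ∀ (w : List Bool) (hw : w.length = j), p.label ⟨i :: w, by simpa [hw] using hj⟩ = x w) :
    IsFullAt P j := by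
  intro x
  obtain ⟨p, hp, hps, hpl⟩ := h x
  obtain ⟨q, hq, hql⟩ := hess p hp i
  refine ⟨q, hq, fun v hv => ?_, fun v hv => ?_⟩
  · exact (hql v.1 (by omega)).trans (hps _ (by simpa using hv))
  · exact (hql v.1 (by omega)).trans (hpl v.1 hv)

/-- Level `d - 2` is filled by sections of elements of `P` supported on level `d - 1`. The higher
levels follow by taking further sections. -/
theorem isFullBelow_of_mul_mem {P : Subgroup (FinTreeAut d)} (hd : 2 ≤ d)
    (hess : IsEssential P)
    (hK : ∀ a ∈ levelStabilizer d (d - 1), ∀ b ∈ levelStabilizer d (d - 1),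
      a ∉ P → b ∉ P → a * b ∈ P) : IsFullBelow P (d - 1) := by
  have hstab : ∀ (y : List Bool → ZMod 2) (i : Bool), ofLabel d
      (fun u => if u.length = d - 1 ∧ u.head? = some i then y u.tail else 0) ∈
        levelStabilizer d (d - 1) := by
    intro y i v hv
    rw [label_ofLabel, if_neg]
    omega
  -- Either all elements supported on level `d - 1` below `0` lie in `P`, or some such element `z`
  -- does not. In the second case, for each `x` placed below `1`, `x` or its product with `z` lies
  -- in `P`, and both have the same section at `1`.
  have hbase : IsFullAt P (d - 2) := by
    by_cases h0 : ∀ y : List Bool → ZMod 2, ofLabel d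
      (fun u => if u.length = d - 1 ∧ u.head? = some false then y u.tail else 0) ∈ P
    · refine IsFullAt.of_section hess (by omega) false fun x => ⟨_, h0 x, ?_, fun w hw => ?_⟩
      · rw [show d - 2 + 1 = d - 1 by omega]; exact hstab x false
      · rw [label_ofLabel, if_pos ⟨by simp; omega, rfl⟩]; rfl
    · push Not at h0
      obtain ⟨z, hz⟩ := h0
      refine IsFullAt.of_section hess (by omega) true fun x => ?_
      by_cases hx : ofLabel d
        (fun u => if u.length = d - 1 ∧ u.head? = some true then x u.tail else 0) ∈ P
      · refine ⟨_, hx, ?_, fun w hw => ?_⟩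
        · rw [show d - 2 + 1 = d - 1 by omega]; exact hstab x true
        · rw [label_ofLabel, if_pos ⟨by simp; omega, rfl⟩]; rfl
      · refine ⟨_, hK _ (hstab x true) _ (hstab z false) hx hz, ?_, fun w hw => ?_⟩
        · rw [show d - 2 + 1 = d - 1 by omega]
          exact mul_mem (hstab x true) (hstab z false)
        · rw [label_mul_of_trivial _ _ (hstab z false) _ (by simp; omega), label_ofLabel,
            label_ofLabel, if_pos ⟨by simp; omega, rfl⟩, if_neg (by simp)]
          simp
  have hdesc : ∀ k j, j + k = d - 2 → IsFullAt P j := by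
    intro k
    induction k with
    | zero => intro j hj; rwa [show j = d - 2 by omega]
    | succ k ih =>
      intro j hj
      refine IsFullAt.of_section hess (by omega) false fun x => ?_
      obtain ⟨p, hp, hps, hpl⟩ := ih (j + 1) (by omega) fun u => x u.tail
      exact ⟨p, hp, hps, fun w hw => hpl _ (by simpa using hw)⟩
  exact isFullBelow_of_isFullAt fun j hj => hdesc (d - 2 - j) j (by omega)

/-- Every coset of `P` meets the stabilizer of level `d - 1`, so the index of `P` can be read off
inside that stabilizer. -/
theorem eq_top_or_index_eq_two {P : Subgroup (FinTreeAut d)} (hd : 2 ≤ d)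
    (hess : IsEssential P) (hK : P.relIndex (levelStabilizer d (d - 1)) ≤ 2) :
    P = ⊤ ∨ P.index = 2 := by
  have hcases : P.relIndex (levelStabilizer d (d - 1)) = 1 ∨
      P.relIndex (levelStabilizer d (d - 1)) = 2 := by
    have : P.relIndex (levelStabilizer d (d - 1)) ≠ 0 := Subgroup.index_ne_zero_of_finite
    omega
  have hmul : ∀ a ∈ levelStabilizer d (d - 1), ∀ b ∈ levelStabilizer d (d - 1),
      a ∉ P → b ∉ P → a * b ∈ P := by
    intro a ha b hb haP hbP
    rcases hcases with h | h
    · exact absurd (Subgroup.relIndex_eq_one.1 h ha) haP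
    · exact (Subgroup.mul_mem_iff_of_index_two (H := P.subgroupOf (levelStabilizer d (d - 1))) h
        (a := ⟨a, ha⟩) (b := ⟨b, hb⟩)).2 (iff_of_false haP hbP)
  have hfull := isFullBelow_of_mul_mem hd hess hmul
  have hdecomp : ∀ g : FinTreeAut d, ∃ h ∈ P, g * h ∈ levelStabilizer d (d - 1) := fun g => by
    obtain ⟨h, hh, hl⟩ := hfull (extendPattern (label g))
    exact ⟨h⁻¹, P.inv_mem hh, mul_inv_mem_levelStabilizer fun v hv => by
      rw [hl v hv, extendPattern_apply]⟩
  by_cases hle : levelStabilizer d (d - 1) ≤ P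
  · left
    rw [eq_top_iff]
    intro g _
    obtain ⟨h, hh, hgh⟩ := hdecomp g
    exact (P.mul_mem_cancel_right hh).1 (hle hgh)
  · right
    obtain ⟨a, ha, haP⟩ := SetLike.not_le_iff_exists.1 hle
    rw [Subgroup.index_eq_two_iff']
    refine ⟨a, fun g => ?_⟩
    obtain ⟨h, hh, hgh⟩ := hdecomp g
    rw [← P.mul_mem_cancel_right hh (y := g), ← P.mul_mem_cancel_right hh (y := a * g), mul_assoc]
    by_cases hg : g * h ∈ P
    · exact Or.inr ⟨hg, fun hc => haP ((P.mul_mem_cancel_right hg).1 hc)⟩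
    · exact Or.inl ⟨hmul _ ha _ hgh haP hg, hg⟩

/-! ### Cardinalities of levels and stabilizers -/

theorem natCard_words (n : ℕ) : Nat.card {w : List Bool // w.length = n} = 2 ^ n := by
  change Nat.card (List.Vector Bool n) = 2 ^ n
  rw [Nat.card_eq_fintype_card, card_vector, Fintype.card_bool]

/-- An element of the stabilizer of the last level of inner vertices, as a labelling of it. -/
def levelStabilizerEquiv (hd : 1 ≤ d) :
    levelStabilizer d (d - 1) ≃ ({w : List Bool // w.length = d - 1} → ZMod 2) where
  toFun g u := label g.1 ⟨u.1, by have := u.2; omega⟩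
  invFun x := ⟨ofLabel d fun w => if h : w.length = d - 1 then x ⟨w, h⟩ else 0, fun v hv => by
    rw [label_ofLabel, dif_neg (by omega)]⟩
  left_inv g := Subtype.ext <| ext_label fun v => by
    rw [label_ofLabel]
    split_ifs with h
    · rfl
    · exact (g.2 v (by have := v.2; omega)).symm
  right_inv x := funext fun u => by
    change label (ofLabel d _) _ = _
    rw [label_ofLabel, dif_pos u.2]

theorem card_levelStabilizer (hd : 1 ≤ d) :
    Nat.card (levelStabilizer d (d - 1)) = 2 ^ 2 ^ (d - 1) := by
  have : Finite {w : List Bool // w.length = d - 1} := List.finite_length_eq Bool (d - 1)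
  rw [Nat.card_congr (levelStabilizerEquiv hd), Nat.card_fun, Nat.card_zmod, natCard_words]

theorem card_innerVertex (n : ℕ) : Fintype.card (InnerVertex n) = 2 ^ n - 1 := by
  rw [← Nat.card_eq_fintype_card]
  induction n with
  | zero =>
    have : IsEmpty (InnerVertex 0) := ⟨fun v => absurd v.2 (by omega)⟩
    simp
  | succ n ih =>
    have e : InnerVertex (n + 1) ≃ InnerVertex n ⊕ {w : List Bool // w.length = n} :=
      { toFun := fun v => if h : v.1.length < n then Sum.inl ⟨v.1, h⟩
          else Sum.inr ⟨v.1, by have := v.2; omega⟩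
        invFun := Sum.elim (fun v => ⟨v.1, by have := v.2; omega⟩)
          (fun v => ⟨v.1, by have := v.2; omega⟩)
        left_inv := fun v => by
          dsimp only
          split_ifs <;> rfl
        right_inv := by
          rintro (v | v)
          · simp [v.2]
          · simp [v.2] }
    have : Finite {w : List Bool // w.length = n} := List.finite_length_eq Bool n
    rw [Nat.card_congr e, Nat.card_sum, ih, natCard_words, pow_succ]
    have := Nat.one_le_two_pow (n := n)
    omega

end FinTreeAut

/-! ### Hausdorff dimension: upper bound -/

namespace TreeAut

theorem le_firstDiff {g h : TreeAut} (hne : g ≠ h) {n : ℕ}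
    (H : ∀ u : List Bool, u.length < n → g.label u = h.label u) : n ≤ firstDiff g h := by
  refine le_csInf ?_ ?_
  · by_contra hem
    refine hne (ext_label fun v => ?_)
    by_contra hv
    exact hem ⟨_, v, rfl, hv⟩
  · rintro k ⟨u, rfl, hu⟩
    by_contra hlt
    exact hu (H u (not_le.1 hlt))

theorem dist_eq_of_ne {g h : TreeAut} (hne : g ≠ h) :
    dist g h = 1 / 2 ^ (2 ^ firstDiff g h - 1) := if_neg hne

theorem dist_le_of_label_eq {g h : TreeAut} {n : ℕ}
    (H : ∀ u : List Bool, u.length < n → g.label u = h.label u) :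
    dist g h ≤ 1 / 2 ^ (2 ^ n - 1) := by
  by_cases hne : g = h
  · rw [hne, dist_self]; positivity
  · rw [dist_eq_of_ne hne]
    have : (2 : ℕ) ^ n ≤ 2 ^ firstDiff g h :=
      Nat.pow_le_pow_right (by norm_num) (le_firstDiff hne H)
    exact one_div_le_one_div_of_le (by positivity)
      (pow_le_pow_right₀ (by norm_num) (by omega))

end TreeAut

theorem mem_constrainedGroup {d : ℕ} {P : Subgroup (FinTreeAut d)} {g : TreeAut} :
    g ∈ constrainedGroup P ↔
      ∀ w : List Bool, ∃ p ∈ P, ∀ v : InnerVertex d, g.label (w ++ v.1) = FinTreeAut.label p v :=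
  mem_treeSubshift_compl_allowed

namespace FinTreeAut

variable {d : ℕ}

/-- The labels of `g` below the last level. -/
def truncate (g : FinTreeAut d) (v : InnerVertex (d - 1)) : ZMod 2 :=
  g.label ⟨v.1, by have := v.2; omega⟩

open Classical in
/-- An element of `P` with the given labels below the last level, if there is one. -/
noncomputable def representative (P : Subgroup (FinTreeAut d)) (r : InnerVertex (d - 1) → ZMod 2) :
    FinTreeAut d :=
  if h : ∃ p ∈ P, truncate p = r then h.choose else 1

theorem mul_representative_inv_mem {P : Subgroup (FinTreeAut d)} {p : FinTreeAut d} (hp : p ∈ P) :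
    p * (representative P (truncate p))⁻¹ ∈ P ⊓ levelStabilizer d (d - 1) := by
  have h : ∃ q ∈ P, truncate q = truncate p := ⟨p, hp, rfl⟩
  rw [representative, dif_pos h]
  exact ⟨P.mul_mem hp (P.inv_mem h.choose_spec.1), mul_inv_mem_levelStabilizer fun v hv =>
    (congrFun h.choose_spec.2 ⟨v.1, hv⟩).symm⟩

/-- The elements of the finitely constrained group with given labels on the levels below `d - 1`
and given extensions of the patterns of size `d - 1` at the words of length less than `j`. -/
def cylinder (P : Subgroup (FinTreeAut d)) (j : ℕ) (i : (InnerVertex (d - 1) → ZMod 2) ×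
    (InnerVertex j → (P ⊓ levelStabilizer d (d - 1) : Subgroup (FinTreeAut d)))) : Set TreeAut :=
  {g | (∀ v : InnerVertex (d - 1), g.label v.1 = i.1 v) ∧ ∀ w : InnerVertex j, ∃ p : FinTreeAut d,
    (∀ v : InnerVertex d, g.label (w.1 ++ v.1) = p.label v) ∧
      p = (i.2 w).1 * representative P (truncate p)}

theorem constrainedGroup_subset_iUnion_cylinder (P : Subgroup (FinTreeAut d)) (j : ℕ) :
    (constrainedGroup P : Set TreeAut) ⊆ ⋃ i, cylinder P j i := by
  intro g hg
  choose p hp hpl using mem_constrainedGroup.1 hg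
  refine Set.mem_iUnion.2 ⟨(fun v => g.label v.1, fun w => ⟨_, mul_representative_inv_mem (hp w.1)⟩),
    fun v => rfl, fun w => ⟨p w.1, hpl w.1, ?_⟩⟩
  rw [inv_mul_cancel_right]

/-- A word of length at least `d - 1` is the bottom position of the pattern at the prefix that omits
its last `d - 1` letters. The upper labels of that pattern agree by induction and select the same
representative; the index of the cylinder then fixes the pattern. -/
theorem label_eq_of_mem_cylinder (hd : 1 ≤ d) {P : Subgroup (FinTreeAut d)} {j : ℕ} {i}
    {g h : TreeAut} (hg : g ∈ cylinder P j i) (hh : h ∈ cylinder P j i) (u : List Bool)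
    (hu : u.length < d - 1 + j) : g.label u = h.label u := by
  induction hn : u.length using Nat.strong_induction_on generalizing u with
  | _ n ih =>
    subst hn
    by_cases hlt : u.length < d - 1
    · exact (hg.1 ⟨u, hlt⟩).trans (hh.1 ⟨u, hlt⟩).symm
    · have hw : (u.take (u.length - (d - 1))).length < j := by
        rw [List.length_take]; omega
      have hv : (u.drop (u.length - (d - 1))).length < d := by
        rw [List.length_drop]; omega
      obtain ⟨p, hp, hpe⟩ := hg.2 ⟨_, hw⟩
      obtain ⟨q, hq, hqe⟩ := hh.2 ⟨_, hw⟩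
      have htr : truncate p = truncate q := by
        funext v
        have hvl := v.2
        have e := ih (u.take (u.length - (d - 1)) ++ v.1).length
          (by rw [List.length_append, List.length_take]; omega) _
          (by rw [List.length_append, List.length_take]; omega) rfl
        exact (hp ⟨v.1, by omega⟩).symm.trans (e.trans (hq ⟨v.1, by omega⟩))
      have hpq : p = q := by rw [hpe, hqe, htr]
      have e1 := hp ⟨_, hv⟩
      have e2 := hq ⟨_, hv⟩
      rw [List.take_append_drop] at e1 e2
      rw [e1, e2, hpq]

open MeasureTheory Filter Topology in
-- At stage `j` there are at most `2 ^ (2 ^ (d - 1) - 1 + m * (2 ^ j - 1))` cylinders, each of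
-- diameter at most `(1 / 2) ^ (2 ^ (d - 1 + j) - 1)`. For `s = m / 2 ^ (d - 1)` the terms in `2 ^
-- j` cancel in the exponent, so the sums of the `s`-th powers stay bounded and the `s`-dimensional
-- Hausdorff measure is finite.
theorem dimH_constrainedGroup_le (hd : 1 ≤ d) (P : Subgroup (FinTreeAut d)) (m : ℕ)
    (hm : Nat.card (P ⊓ levelStabilizer d (d - 1) : Subgroup (FinTreeAut d)) ≤ 2 ^ m) :
    dimH (constrainedGroup P : Set TreeAut) ≤ ENNReal.ofReal (m / 2 ^ (d - 1)) := by
  borelize TreeAut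
  let : Fintype (P ⊓ levelStabilizer d (d - 1) : Subgroup (FinTreeAut d)) := Fintype.ofFinite _
  set s : ℝ := m / 2 ^ (d - 1) with hs
  have hs0 : 0 ≤ s := by positivity
  have hdiam : ∀ j i, Metric.ediam (cylinder P j i) ≤
      ENNReal.ofReal ((1 / 2) ^ (2 ^ (d - 1 + j) - 1)) := by
    intro j i
    refine Metric.ediam_le fun g hg h hh => ?_
    rw [edist_dist]
    refine ENNReal.ofReal_le_ofReal ?_
    rw [one_div_pow]
    exact TreeAut.dist_le_of_label_eq (label_eq_of_mem_cylinder hd hg hh)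
  have hr : Tendsto (fun j : ℕ => ENNReal.ofReal ((1 / 2) ^ (2 ^ (d - 1 + j) - 1))) atTop (𝓝 0) := by
    rw [← ENNReal.ofReal_zero]
    refine ENNReal.tendsto_ofReal ((tendsto_pow_atTop_nhds_zero_of_lt_one (by norm_num)
      (by norm_num)).comp (tendsto_atTop_mono (fun j => ?_) tendsto_id))
    have := Nat.lt_two_pow_self (n := d - 1 + j)
    simp only [id]
    omega
  have hbound : ∀ j : ℕ, ∑ i, Metric.ediam (cylinder P j i) ^ s ≤
      ENNReal.ofReal (2 ^ (2 ^ (d - 1) + m)) := by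
    intro j
    have hpow : ∀ n : ℕ, ((2 ^ n - 1 : ℕ) : ℝ) = 2 ^ n - 1 := fun n => by
      rw [Nat.cast_sub Nat.one_le_two_pow]; simp
    calc ∑ i, Metric.ediam (cylinder P j i) ^ s
        ≤ ∑ i, ENNReal.ofReal (((1 / 2) ^ (2 ^ (d - 1 + j) - 1)) ^ s) := by
          refine Finset.sum_le_sum fun i _ => ?_
          rw [← ENNReal.ofReal_rpow_of_nonneg (by positivity) hs0]
          exact ENNReal.rpow_le_rpow (hdiam j i) hs0
      _ ≤ ENNReal.ofReal (2 ^ (2 ^ (d - 1) + m)) := by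
          rw [Finset.sum_const, ← ENNReal.ofReal_nsmul, Finset.card_univ, Fintype.card_prod,
            Fintype.card_fun, Fintype.card_fun, ZMod.card, card_innerVertex, card_innerVertex,
            ← Nat.card_eq_fintype_card, nsmul_eq_mul]
          refine ENNReal.ofReal_le_ofReal ?_
          have h1 : ((2 ^ (2 ^ (d - 1) - 1) * Nat.card (P ⊓ levelStabilizer d (d - 1) :
              Subgroup (FinTreeAut d)) ^ (2 ^ j - 1) : ℕ) : ℝ) ≤
              (2 : ℝ) ^ (((2 : ℝ) ^ (d - 1) - 1) + m * (2 ^ j - 1)) := by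
            calc _ ≤ ((2 ^ (2 ^ (d - 1) - 1) * (2 ^ m) ^ (2 ^ j - 1) : ℕ) : ℝ) := by
                  exact_mod_cast Nat.mul_le_mul_left _ (Nat.pow_le_pow_left hm _)
              _ = _ := by
                  rw [← pow_mul, ← pow_add, ← hpow, ← hpow]
                  push_cast [← Real.rpow_natCast]
                  rfl
          have h2 : (((1 : ℝ) / 2) ^ (2 ^ (d - 1 + j) - 1)) ^ s =
              (2 : ℝ) ^ (-(((2 : ℝ) ^ (d - 1 + j) - 1) * s)) := by
            rw [one_div, inv_pow, Real.inv_rpow (by positivity), Real.rpow_neg (by norm_num),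
              ← Real.rpow_natCast, ← Real.rpow_mul (by norm_num), hpow]
          rw [h2]
          refine (mul_le_mul_of_nonneg_right h1 (by positivity)).trans ?_
          rw [← Real.rpow_add (by norm_num), ← Real.rpow_natCast 2 (2 ^ (d - 1) + m)]
          refine Real.rpow_le_rpow_of_exponent_le (by norm_num) ?_
          have h3 : (2 : ℝ) ^ (d - 1 + j) * s = m * 2 ^ j := by
            rw [hs, pow_add]; field_simp
          have h4 : s ≤ m := div_le_self (by positivity) (one_le_pow₀ (by norm_num))
          have h5 : (0 : ℝ) ≤ m := by positivity
          push_cast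
          linarith
  have hμ : Measure.hausdorffMeasure (s.toNNReal : ℝ) (constrainedGroup P : Set TreeAut) ≤
      ENNReal.ofReal (2 ^ (2 ^ (d - 1) + m)) := by
    rw [Real.coe_toNNReal _ hs0]
    refine (Measure.hausdorffMeasure_le_liminf_sum s _ _ hr (fun j i => cylinder P j i)
      (Eventually.of_forall hdiam)
      (Eventually.of_forall (constrainedGroup_subset_iUnion_cylinder P))).trans ?_
    exact (liminf_le_liminf (Eventually.of_forall hbound)).trans (by rw [liminf_const])
  exact dimH_le_of_hausdorffMeasure_ne_top (hμ.trans_lt ENNReal.ofReal_lt_top).ne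

end FinTreeAut

/-! ### Hausdorff dimension: lower bound -/

/-- The number of a word in the shortlex order, starting with `1` at the empty word. -/
def wordCode (w : List Bool) : ℕ := w.foldl (fun n x => 2 * n + x.toNat) 1

theorem wordCode_concat (w : List Bool) (x : Bool) :
    wordCode (w ++ [x]) = 2 * wordCode w + x.toNat := by
  simp [wordCode]

theorem two_pow_length_le_wordCode (w : List Bool) : 2 ^ w.length ≤ wordCode w := by
  induction w using List.reverseRecOn with
  | nil => simp [wordCode]
  | append_singleton w x ih =>
    rw [wordCode_concat, List.length_append, List.length_singleton, pow_succ]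
    omega

theorem exists_wordCode_eq {n : ℕ} (hn : n ≠ 0) : ∃ w, wordCode w = n := by
  induction n using Nat.strong_induction_on with
  | _ n ih =>
    rcases (by omega : n = 1 ∨ 2 ≤ n) with rfl | h2
    · exact ⟨[], rfl⟩
    · obtain ⟨w, hw⟩ := ih (n / 2) (by omega) (by omega)
      refine ⟨w ++ [decide (n % 2 = 1)], ?_⟩
      rw [wordCode_concat, hw]
      rcases Nat.mod_two_eq_zero_or_one n with h | h <;> simp [h] <;> omega

/-- The code is the number whose binary expansion is the word with a `1` put in front. -/
theorem dvd_wordCode_of_suffix {e : ℕ} {w : List Bool} (h : List.replicate e false <:+ w) :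
    2 ^ e ∣ wordCode w := by
  obtain ⟨u, rfl⟩ := h
  refine ⟨wordCode u, ?_⟩
  induction e with
  | zero => simp
  | succ e ih =>
    rw [List.replicate_succ', ← List.append_assoc, wordCode_concat, ih, pow_succ]
    simp; ring

/-- The increasing enumeration of the positive integers that are not divisible by `D`. -/
def nonMultiple (D j : ℕ) : ℕ := j + j / (D - 1) + 1

theorem nonMultiple_strictMono (D : ℕ) : StrictMono (nonMultiple D) := by
  intro i j h
  have := Nat.div_le_div_right (c := D - 1) h.le
  unfold nonMultiple
  omega

theorem not_dvd_nonMultiple {D : ℕ} (hD : 2 ≤ D) (j : ℕ) : ¬ D ∣ nonMultiple D j := by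
  obtain ⟨E, rfl⟩ := Nat.exists_eq_add_of_le' (show 1 ≤ D by omega)
  have h1 := Nat.div_add_mod j E
  have h2 := Nat.mod_lt j (show E > 0 by omega)
  have h3 : nonMultiple (E + 1) j = (E + 1) * (j / E) + (j % E + 1) := by
    rw [nonMultiple, Nat.add_sub_cancel]
    linarith
  rw [h3, ← Nat.dvd_add_iff_right (dvd_mul_right _ _)]
  exact Nat.not_dvd_of_pos_of_lt (by omega) (by omega)

/-- This is the density of the enumeration: a proportion of about `(D - 1) / D` of the integers up
to `M` are non-multiples of `D`. -/
theorem nonMultiple_lt {D : ℕ} (hD : 2 ≤ D) {j M : ℕ} (h : j * D < (D - 1) * M) :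
    nonMultiple D j < M + 1 := by
  obtain ⟨E, rfl⟩ := Nat.exists_eq_add_of_le' (show 1 ≤ D by omega)
  rw [nonMultiple]
  rw [Nat.add_sub_cancel] at *
  have h1 := Nat.div_mul_le_self j E
  have : E * (j + j / E) < E * M := by linarith
  have := Nat.lt_of_mul_lt_mul_left this
  omega

/-- A set of automorphisms whose labels are arbitrary at the words that do not end with `0 ^ e` has
Hausdorff dimension at least `1 - 1 / 2 ^ e`. -/
theorem le_dimH_of_free_labels {e : ℕ} (he : 1 ≤ e) {A : Set TreeAut}
    (hA : ∀ x : List Bool → ZMod 2, ∃ g ∈ A, ∀ w, ¬ List.replicate e false <:+ w → g.label w = x w) :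
    ENNReal.ofReal (1 - 1 / 2 ^ e) ≤ dimH A := by
  have hD : 2 ≤ 2 ^ e := by
    calc 2 = 2 ^ 1 := rfl
      _ ≤ 2 ^ e := Nat.pow_le_pow_right (by norm_num) he
  have hD' : (2 : ℝ) ≤ 2 ^ e := by exact_mod_cast hD
  choose word hword using fun j => exists_wordCode_eq (n := nonMultiple (2 ^ e) j) (by simp [nonMultiple])
  have hsuff : ∀ j, ¬ List.replicate e false <:+ word j := fun j h =>
    not_dvd_nonMultiple hD j (hword j ▸ dvd_wordCode_of_suffix h)
  have hinj : Function.Injective word := fun i j h =>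
    (nonMultiple_strictMono (2 ^ e)).injective (by rw [← hword, ← hword, h])
  set s : ℝ := 1 - 1 / 2 ^ e with hs
  have hs0 : 0 < s := by
    rw [hs, sub_pos, div_lt_one (by positivity)]
    linarith
  -- The free labels, listed in shortlex order, become the binary digits of a real number.
  let f : TreeAut → ℝ := fun g => Real.ofDigits fun j => (g.label (word j) : Fin 2)
  have hf : HolderOnWith 1 s.toNNReal f A := by
    intro g _ h _
    rw [edist_dist, edist_dist, Real.coe_toNNReal _ hs0.le, ENNReal.coe_one, one_mul,
      ENNReal.ofReal_rpow_of_nonneg dist_nonneg hs0.le]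
    refine ENNReal.ofReal_le_ofReal ?_
    by_cases hgh : g = h
    · rw [hgh, dist_self]; positivity
    set n := TreeAut.firstDiff g h with hn
    -- Words with code below `2 ^ n` have length less than `n`, where `g` and `h` agree. The density
    -- estimate puts at least `s * (2 ^ n - 1)` of the listed words among them, so this many binary
    -- digits coincide, matching `dist g h ^ s`.
    have hlab : ∀ j < ⌈s * (2 ^ n - 1)⌉₊, (g.label (word j) : Fin 2) = (h.label (word j) : Fin 2) := by
      intro j hj
      refine TreeAut.label_eq_of_lt ?_
      rw [← hn]
      have h1 : (j : ℝ) < s * (2 ^ n - 1) := Nat.lt_ceil.1 hj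
      have h2 : (j : ℝ) * 2 ^ e < (2 ^ e - 1) * (2 ^ n - 1) := by
        have := mul_lt_mul_of_pos_right h1 (show (0 : ℝ) < 2 ^ e by positivity)
        have e1 : s * (2 ^ n - 1) * 2 ^ e = (2 ^ e - 1) * ((2 : ℝ) ^ n - 1) := by
          rw [hs]; field_simp
        rwa [e1] at this
      have h3 : j * 2 ^ e < (2 ^ e - 1) * (2 ^ n - 1) := by
        rw [← Nat.cast_lt (α := ℝ)]
        push_cast [Nat.cast_sub (Nat.one_le_two_pow (n := e)),
          Nat.cast_sub (Nat.one_le_two_pow (n := n))]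
        exact h2
      have h4 := nonMultiple_lt hD h3
      rw [Nat.sub_add_cancel Nat.one_le_two_pow, ← hword] at h4
      exact (Nat.pow_lt_pow_iff_right (by norm_num)).1
        ((two_pow_length_le_wordCode _).trans_lt h4)
    rw [Real.dist_eq, TreeAut.dist_eq_of_ne hgh, ← hn]
    refine (Real.abs_ofDigits_sub_ofDigits_le hlab).trans ?_
    have h5 : ((1 : ℝ) / 2 ^ (2 ^ n - 1)) ^ s = ((2 : ℝ) ^ (s * (2 ^ n - 1)))⁻¹ := by
      rw [one_div, Real.inv_rpow (by positivity), ← Real.rpow_natCast, ← Real.rpow_mul (by norm_num),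
        Nat.cast_sub Nat.one_le_two_pow]
      push_cast
      rw [mul_comm]
    rw [h5, ← Real.rpow_natCast]
    refine inv_anti₀ (by positivity) ?_
    push_cast
    exact Real.rpow_le_rpow_of_exponent_le (by norm_num) (Nat.le_ceil _)
  have hsurj : Set.Ico (0 : ℝ) 1 ⊆ f '' A := by
    intro x hx
    -- Outside the listed words `invFun` takes arbitrary values, which do not affect `f`.
    obtain ⟨g, hg, hgl⟩ := hA fun w => (Real.digits x 2 (Function.invFun word w) : Fin 2)
    refine ⟨g, hg, ?_⟩
    have : (fun j => (g.label (word j) : Fin 2)) = Real.digits x 2 := by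
      funext j
      rw [hgl _ (hsuff j), Function.leftInverse_invFun hinj]
    change Real.ofDigits (fun j => (g.label (word j) : Fin 2)) = x
    rw [this, Real.ofDigits_digits (by norm_num) hx]
  have h1 : (1 : ENNReal) ≤ dimH (f '' A) := by
    have : dimH (Set.Ico (0 : ℝ) 1) = 1 := by
      rw [Real.dimH_of_nonempty_interior (by simp)]
      simp
    exact this ▸ dimH_mono hsurj
  have h2 := h1.trans (hf.dimH_image_le (Real.toNNReal_pos.2 hs0))
  have h3 : ((s.toNNReal : NNReal) : ENNReal) ≠ 0 := by
    simpa using hs0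
  rw [ENNReal.le_div_iff_mul_le (Or.inl h3) (Or.inl ENNReal.coe_ne_top), one_mul] at h2
  exact h2

/-- All labellings are allowed here, so `e` is independent of `d`; taking `e = d` is enough to
exceed the dimension in the theorem. -/
theorem dimH_constrainedGroup_top_ge (d : ℕ) {e : ℕ} (he : 1 ≤ e) :
    ENNReal.ofReal (1 - 1 / 2 ^ e) ≤
      dimH (constrainedGroup (⊤ : Subgroup (FinTreeAut d)) : Set TreeAut) := by
  refine le_dimH_of_free_labels he fun x => ⟨TreeAut.ofLabel x, mem_constrainedGroup.2 fun w =>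
    ⟨FinTreeAut.ofLabel d fun v => x (w ++ v), trivial, fun v => ?_⟩,
    fun w _ => TreeAut.label_ofLabel x w⟩
  rw [TreeAut.label_ofLabel, FinTreeAut.label_ofLabel]

/-! ### Elements of a constrained group with prescribed labels -/

/-- The labelling in which the label at `w` is computed by `c` from the labels at the shorter
words. -/
def recursiveLabel (c : List Bool → (List Bool → ZMod 2) → ZMod 2) (w : List Bool) : ZMod 2 :=
  c w fun u => if u.length < w.length then recursiveLabel c u else 0
termination_by w.length

theorem recursiveLabel_eq (c : List Bool → (List Bool → ZMod 2) → ZMod 2) (w : List Bool) :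
    recursiveLabel c w = c w fun u => if u.length < w.length then recursiveLabel c u else 0 := by
  rw [recursiveLabel]

/-- Each occurrence of a pattern is made admissible by adjusting its label at `0 ^ (d - 1)`. A word
ending with `0 ^ (d - 1)` holds this position for exactly one occurrence, so the adjustments do not
conflict. -/
theorem exists_mem_constrainedGroup {d : ℕ} (hd : 1 ≤ d) {P : Subgroup (FinTreeAut d)}
    (hP : P.index = 2) (ha : generatorA d (d - 1) ∉ P) (x : List Bool → ZMod 2) :
    ∃ g ∈ constrainedGroup P, ∀ w, ¬ List.replicate (d - 1) false <:+ w → g.label w = x w := by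
  classical
  choose b q hq hql using FinTreeAut.exists_correction hP ha
  -- The recursion may use only shorter words, so labels on the bottom level of the pattern are
  -- taken from `x`. They are the true labels except at `0 ^ (d - 1)`, where the correction
  -- overwrites the value.
  let c : List Bool → (List Bool → ZMod 2) → ZMod 2 := fun w r =>
    if List.replicate (d - 1) false <:+ w then
      b fun v => if v.1.length < d - 1 then r (w.take (w.length - (d - 1)) ++ v.1)
        else x (w.take (w.length - (d - 1)) ++ v.1)
    else x w
  have hfree : ∀ w, ¬ List.replicate (d - 1) false <:+ w → recursiveLabel c w = x w := fun w hw => by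
    rw [recursiveLabel_eq]; exact if_neg hw
  let p : List Bool → Pattern d := fun w v =>
    if v.1.length < d - 1 then recursiveLabel c (w ++ v.1) else x (w ++ v.1)
  have hdet : ∀ w, recursiveLabel c (w ++ List.replicate (d - 1) false) = b (p w) := fun w => by
    rw [recursiveLabel_eq]
    refine (if_pos (List.suffix_append _ _)).trans ?_
    congr 1
    funext v
    have : (w ++ List.replicate (d - 1) false).take
        ((w ++ List.replicate (d - 1) false).length - (d - 1)) = w := by
      simp
    rw [this]
    refine ite_congr rfl (fun hv => if_pos ?_) fun _ => rfl
    simpa using hv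
  refine ⟨TreeAut.ofLabel (recursiveLabel c), mem_constrainedGroup.2 fun w => ⟨q (p w), hq _,
    fun v => ?_⟩, fun w hw => by rw [TreeAut.label_ofLabel, hfree w hw]⟩
  rw [TreeAut.label_ofLabel, hql]
  split_ifs with hv
  · rw [hv, hdet]
  · by_cases hl : v.1.length < d - 1
    · exact (if_pos hl).symm
    · refine (hfree _ fun hs => hv ?_).trans (if_neg hl).symm
      have hlen : v.1.length = d - 1 := by have := v.2; omega
      have h1 : List.replicate (d - 1) false <:+ v.1 :=
        List.suffix_of_suffix_length_le hs (List.suffix_append _ _) (by simp [hlen])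
      exact (h1.eq_of_length (by simp [hlen])).symm

/-! ### The characterization of maximal Hausdorff dimension -/

namespace FinTreeAut

variable {d : ℕ}

theorem card_inf_levelStabilizer_mul_relIndex (hd : 1 ≤ d) (P : Subgroup (FinTreeAut d)) :
    Nat.card (P ⊓ levelStabilizer d (d - 1) : Subgroup (FinTreeAut d)) *
      P.relIndex (levelStabilizer d (d - 1)) = 2 ^ 2 ^ (d - 1) := by
  have h := Subgroup.relIndex_mul_relIndex ⊥ (P ⊓ levelStabilizer d (d - 1))
    (levelStabilizer d (d - 1)) bot_le inf_le_right
  rwa [Subgroup.relIndex_bot_left, Subgroup.relIndex_bot_left, Subgroup.inf_relIndex_right,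
    card_levelStabilizer hd] at h

theorem card_inf_levelStabilizer_le (hd : 1 ≤ d) {P : Subgroup (FinTreeAut d)} {k : ℕ}
    (hk : k ≤ 2 ^ (d - 1)) (h : 2 ^ k ≤ P.relIndex (levelStabilizer d (d - 1))) :
    Nat.card (P ⊓ levelStabilizer d (d - 1) : Subgroup (FinTreeAut d)) ≤
      2 ^ (2 ^ (d - 1) - k) := by
  have h1 := card_inf_levelStabilizer_mul_relIndex hd P
  refine Nat.le_of_mul_le_mul_right (c := 2 ^ k) ?_ (by positivity)
  rw [← pow_add, Nat.sub_add_cancel hk, ← h1]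
  exact Nat.mul_le_mul_left _ h

theorem two_le_two_pow_pred (hd : 2 ≤ d) : 2 ≤ 2 ^ (d - 1) := by
  calc 2 = 2 ^ 1 := rfl
    _ ≤ 2 ^ (d - 1) := Nat.pow_le_pow_right (by norm_num) (by omega)

/-- The index is a power of two; if it exceeded 2 it would be at least 4, and the counting bound
would be at most `1 - 2 / 2 ^ (d - 1)`. -/
theorem relIndex_le_two_of_dimH_eq (hd : 2 ≤ d) {P : Subgroup (FinTreeAut d)}
    (h : dimH (constrainedGroup P : Set TreeAut) = ENNReal.ofReal (1 - 1 / 2 ^ (d - 1))) :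
    P.relIndex (levelStabilizer d (d - 1)) ≤ 2 := by
  by_contra hlt
  have hD := two_le_two_pow_pred hd
  obtain ⟨k, -, hk⟩ := (Nat.dvd_prime_pow Nat.prime_two).1
    (Dvd.intro_left _ (card_inf_levelStabilizer_mul_relIndex (by omega) P))
  have hk2 : 2 ≤ k := by
    by_contra hk'
    rcases (by omega : k = 0 ∨ k = 1) with rfl | rfl <;> omega
  have h4 : 2 ^ 2 ≤ P.relIndex (levelStabilizer d (d - 1)) :=
    hk ▸ Nat.pow_le_pow_right (by norm_num) hk2
  have hle := dimH_constrainedGroup_le (by omega) P _ (card_inf_levelStabilizer_le (by omega) hD h4)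
  rw [h] at hle
  have hD' : (2 : ℝ) ≤ 2 ^ (d - 1) := by exact_mod_cast hD
  rw [ENNReal.ofReal_le_ofReal_iff (by positivity), Nat.cast_sub hD, le_div_iff₀ (by positivity),
    sub_mul, one_div_mul_cancel (by positivity)] at hle
  push_cast at hle
  linarith

theorem index_eq_two_of_dimH_eq (hd : 2 ≤ d) {P : Subgroup (FinTreeAut d)} (hess : IsEssential P)
    (h : dimH (constrainedGroup P : Set TreeAut) = ENNReal.ofReal (1 - 1 / 2 ^ (d - 1))) :
    P.index = 2 := by
  refine (eq_top_or_index_eq_two hd hess (relIndex_le_two_of_dimH_eq hd h)).resolve_left ?_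
  rintro rfl
  have hle := dimH_constrainedGroup_top_ge d (e := d) (by omega)
  rw [h, ENNReal.ofReal_le_ofReal_iff'] at hle
  have hlt : (1 : ℝ) / 2 ^ d < 1 / 2 ^ (d - 1) :=
    one_div_lt_one_div_of_lt (by positivity) (pow_lt_pow_right₀ (by norm_num) (by omega))
  have hlt' : (1 : ℝ) / 2 ^ d < 1 := by
    rw [div_lt_one (by positivity)]
    exact one_lt_pow₀ (by norm_num) (by omega)
  rcases hle with hle | hle <;> linarith

theorem index_eq_two_of_isCoatom {P : Subgroup (FinTreeAut d)} (hP : IsCoatom P) : P.index = 2 :=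
  _root_.index_eq_two_of_isCoatom (card_eq_two_pow d) hP

theorem dimH_eq_of_isCoatom (hd : 2 ≤ d) {P : Subgroup (FinTreeAut d)} (hP : IsCoatom P)
    (ha : generatorA d (d - 1) ∉ P) :
    dimH (constrainedGroup P : Set TreeAut) = ENNReal.ofReal (1 - 1 / 2 ^ (d - 1)) := by
  have hD := two_le_two_pow_pred hd
  refine le_antisymm ?_ (le_dimH_of_free_labels (by omega)
    (exists_mem_constrainedGroup (by omega) (index_eq_two_of_isCoatom hP) ha))
  have hne0 : P.relIndex (levelStabilizer d (d - 1)) ≠ 0 := Subgroup.index_ne_zero_of_finite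
  -- The element `a_{d-1}` itself shows that `P` misses part of the stabilizer, which saves one
  -- factor of 2 in the count.
  have hne1 : P.relIndex (levelStabilizer d (d - 1)) ≠ 1 := fun h =>
    ha (Subgroup.relIndex_eq_one.1 h (generatorA_mem_levelStabilizer d _))
  refine (dimH_constrainedGroup_le (by omega) P _
    (card_inf_levelStabilizer_le (k := 1) (by omega) (by omega) (by omega))).trans_eq ?_
  congr 1
  rw [Nat.cast_sub (by omega)]
  push_cast
  field_simp

theorem tfae_dimH (hd : 2 ≤ d) {P : Subgroup (FinTreeAut d)} (hess : IsEssential P) :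
    List.TFAE [
      dimH (constrainedGroup P : Set TreeAut) = ENNReal.ofReal (1 - 1 / 2 ^ (d - 1)),
      P ≠ ⊤ ∧ commutator (FinTreeAut d) ≤ P,
      IsCoatom P ∧ generatorA d (d - 1) ∉ P] := by
  tfae_have 1 → 2 := fun h =>
    have hP := index_eq_two_of_dimH_eq hd hess h
    ⟨(isCoatom_of_index_eq_two hP).1, commutator_le_of_index_eq_two hP⟩
  tfae_have 2 → 3 := fun h => isCoatom_of_commutator_le hess h.1 h.2
  tfae_have 3 → 1 := fun h => dimH_eq_of_isCoatom hd h.1 h.2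
  tfae_finish

/-! ### Counting -/

/-- The sum of the last level sum and of the level sums selected by `c`. -/
noncomputable def weightedSum (c : Fin (d - 1) → ZMod 2) :
    FinTreeAut d →* Multiplicative (ZMod 2) :=
  levelSum (d - 1) * ∏ i : Fin (d - 1), if c i = 1 then levelSum i.1 else 1

theorem weightedSum_generatorA_last (hd : 1 ≤ d) (c : Fin (d - 1) → ZMod 2) :
    weightedSum c (generatorA d (d - 1)) = Multiplicative.ofAdd 1 := by
  rw [weightedSum, MonoidHom.mul_apply, MonoidHom.finsetProd_apply,
    levelSum_generatorA _ _ (by omega), if_pos rfl, Finset.prod_eq_one, mul_one]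
  intro i _
  split_ifs
  · rw [levelSum_generatorA _ _ (by omega), if_neg (by omega), ofAdd_zero]
  · rfl

theorem weightedSum_generatorA (c : Fin (d - 1) → ZMod 2) (j : Fin (d - 1)) :
    weightedSum c (generatorA d j) = Multiplicative.ofAdd (c j) := by
  have hj := j.2
  rw [weightedSum, MonoidHom.mul_apply, MonoidHom.finsetProd_apply,
    levelSum_generatorA _ _ (by omega), if_neg (by omega), ofAdd_zero, one_mul,
    Finset.prod_eq_single j]
  · rcases zmod_two_cases (c j) with h | h
    · rw [h, if_neg (by decide)]; rfl
    · rw [h, if_pos rfl, levelSum_generatorA _ _ (by omega), if_pos rfl]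
  · intro i _ hij
    split_ifs
    · rw [levelSum_generatorA _ _ (by omega), if_neg fun h => hij (Fin.ext h.symm), ofAdd_zero]
    · rfl
  · intro h; exact absurd (Finset.mem_univ j) h

theorem index_ker_weightedSum (hd : 1 ≤ d) (c : Fin (d - 1) → ZMod 2) :
    (weightedSum c).ker.index = 2 := by
  rw [Subgroup.index_eq_two_iff]
  refine ⟨generatorA d (d - 1), fun g => ?_⟩
  rw [MonoidHom.mem_ker, MonoidHom.mem_ker, map_mul, weightedSum_generatorA_last hd]
  generalize weightedSum c g = x
  revert x; decide

theorem generatorA_notMem_ker_weightedSum (hd : 1 ≤ d) (c : Fin (d - 1) → ZMod 2) :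
    generatorA d (d - 1) ∉ (weightedSum c).ker := by
  rw [MonoidHom.mem_ker, weightedSum_generatorA_last hd]
  decide

/-- The labels to be matched lie above level `d - 1`, so the correction at `0 ^ (d - 1)` does not
disturb them. -/
theorem isEssential_of_index_eq_two {P : Subgroup (FinTreeAut d)} (hP : P.index = 2)
    (ha : generatorA d (d - 1) ∉ P) : IsEssential P := by
  intro g _ i
  obtain ⟨b, h, hh, hl⟩ := exists_correction hP ha fun v => extendPattern (label g) (i :: v.1)
  refine ⟨h, hh, fun w hw => ?_⟩
  rw [hl, if_neg]
  · exact extendPattern_apply (label g) ⟨i :: w, hw⟩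
  · intro he
    have : w.length = d - 1 := by simpa using congrArg List.length he
    omega

theorem ker_weightedSum_injective (d : ℕ) :
    Function.Injective fun c : Fin (d - 1) → ZMod 2 => (weightedSum c).ker := by
  intro c c' h
  funext j
  have h1 : generatorA d j ∈ (weightedSum c).ker ↔ generatorA d j ∈ (weightedSum c').ker := by
    rw [show (weightedSum c).ker = (weightedSum c').ker from h]
  simp only [MonoidHom.mem_ker, weightedSum_generatorA, ofAdd_eq_one] at h1
  rcases zmod_two_cases (c j) with h2 | h2 <;> rcases zmod_two_cases (c' j) with h3 | h3 <;>
    simp_all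

/-- The homomorphism with kernel `P` takes the nontrivial value at `a_{d-1}`, and its values at the
other `a_i` serve as the weights. -/
theorem exists_eq_ker_weightedSum {P : Subgroup (FinTreeAut d)} (hP : P.index = 2)
    (ha : generatorA d (d - 1) ∉ P) : ∃ c : Fin (d - 1) → ZMod 2, (weightedSum c).ker = P := by
  refine ⟨fun i => Multiplicative.toAdd (indexTwoHom P hP (generatorA d i)), ?_⟩
  have : weightedSum (fun i : Fin (d - 1) =>
      Multiplicative.toAdd (indexTwoHom P hP (generatorA d i))) = indexTwoHom P hP := by
    refine hom_ext fun i hi => ?_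
    rcases (by omega : i < d - 1 ∨ i = d - 1) with h | rfl
    · exact weightedSum_generatorA _ ⟨i, h⟩
    · rw [weightedSum_generatorA_last (by omega)]
      simp [indexTwoHom, ha]
  ext g
  rw [this, MonoidHom.mem_ker, indexTwoHom_eq_one_iff]

theorem ncard_index_eq_two (hd : 1 ≤ d) :
    {P : Subgroup (FinTreeAut d) | P.index = 2 ∧ generatorA d (d - 1) ∉ P}.ncard =
      2 ^ (d - 1) := by
  have : {P : Subgroup (FinTreeAut d) | P.index = 2 ∧ generatorA d (d - 1) ∉ P} =
      Set.range fun c : Fin (d - 1) → ZMod 2 => (weightedSum c).ker := by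
    ext P
    constructor
    · rintro ⟨hP, ha⟩
      exact exists_eq_ker_weightedSum hP ha
    · rintro ⟨c, rfl⟩
      exact ⟨index_ker_weightedSum hd c, generatorA_notMem_ker_weightedSum hd c⟩
  rw [this, ← Nat.card_coe_set_eq, Nat.card_range_of_injective (ker_weightedSum_injective d),
    Nat.card_fun, Nat.card_zmod, Nat.card_fin]

end FinTreeAut

theorem theorem1 (d : ℕ) (hd : 2 ≤ d) :
    (∀ P : Subgroup (FinTreeAut d), IsEssential P →
      List.TFAE [
        dimH (constrainedGroup P : Set TreeAut) = ENNReal.ofReal (1 - 1 / 2 ^ (d - 1)),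
        P ≠ ⊤ ∧ commutator (FinTreeAut d) ≤ P,
        IsCoatom P ∧ generatorA d (d - 1) ∉ P]) ∧
    {P : Subgroup (FinTreeAut d) | IsEssential P ∧
      dimH (constrainedGroup P : Set TreeAut) =
        ENNReal.ofReal (1 - 1 / 2 ^ (d - 1))}.ncard = 2 ^ (d - 1) := by
  refine ⟨fun P hess => FinTreeAut.tfae_dimH hd hess, ?_⟩
  rw [← FinTreeAut.ncard_index_eq_two (d := d) (by omega)]
  congr 1
  ext P
  constructor
  · rintro ⟨hess, hdim⟩
    have h : IsCoatom P ∧ generatorA d (d - 1) ∉ P :=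
      ((FinTreeAut.tfae_dimH hd hess).out 0 2).1 hdim
    exact ⟨FinTreeAut.index_eq_two_of_isCoatom h.1, h.2⟩
  · rintro ⟨hP, ha⟩
    exact ⟨FinTreeAut.isEssential_of_index_eq_two hP ha,
      FinTreeAut.dimH_eq_of_isCoatom hd (isCoatom_of_index_eq_two hP) ha⟩
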